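/- Let $g$ be a finite-dimensional complex simple Lie algebra with Cartan subalgebra $\mathcal H$ and simple roots $\alpha_1,\dots,\alpha_r$, let $a_{ij}=2(\alpha_i,\alpha_j)/(\alpha_i,\alpha_i)$ be its Cartan matrix, and let $d_i$ be the coprime positive integers such that $(d_ia_{ij})$ is symmetric. Put $q=e^h\in\mathbb C[[h]]$, $q_i=e^{d_ih}$. Let $U_h(g)$ be the quantized enveloping algebra, i.e. the $h$-adically complete $\mathbb C[[h]]$-algebra topologically generated by $h_i,x_i^\pm$ ($1\le i\le r$) with relations $$[h_i,h_j]=0,\quad [h_i,x_j^\pm]=\pm a_{ij}x_j^\pm,\quad [x_i^+,x_j^-]=\delta_{ij}\frac{q_i^{h_i}-q_i^{-h_i}}{q_i-q_i^{-1}},\quad \sum_{k=0}^{1-a_{ij}}(-1)^k\left[{1-a_{ij}\atop k}\right]_{q_i}(x_i^\pm)^kx_j^\pm(x_i^\pm)^{1-a_{ij}-k}=0\ (i\ne j)$$ (precisely: the quotient of the $h$-adic completion of the free $\mathbb C[[h]]$-algebra on the generators by the $h$-adic closure of the two-sided ideal generated by the relations; the brackets are the symmetric $q$-binomial coefficients).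 Let $\hat\otimes$ be the $h$-adically completed tensor product over $\mathbb C[[h]]$. Let the comultiplication $\Delta:U_h(g)\to U_h(g)\hat\otimes U_h(g)$ and the counit $\epsilon:U_h(g)\to\mathbb C[[h]]$ be the $\mathbb C[[h]]$-algebra homomorphisms, $S:U_h(g)\to U_h(g)$ (the antipode) the $\mathbb C[[h]]$-linear algebra anti-automorphism, and $\theta:U_h(g)\to U_h(g)$ (the Cartan involution) the $\mathbb C[[h]]$-algebra homomorphism with $$\Delta(h_i)=h_i\otimes1+1\otimes h_i,\quad \Delta(x_i^\pm)=x_i^\pm\otimes q_i^{h_i/2}+q_i^{-h_i/2}\otimes x_i^\pm,\quad \epsilon(h_i)=\epsilon(x_i^\pm)=0,$$ $$S(h_i)=-h_i,\quad S(x_i^\pm)=-q_i^{\pm1}x_i^\pm,\quad \theta(h_i)=-h_i,\quad\theta(x_i^\pm)=x_i^\mp .$$ Write $\Delta^T$ for $\Delta$ followed by the flip of the two tensor factors, and $x\circ y=\sum x_{(1)}\,y\,S(x_{(2)})$, $x\bullet y=\sum x_{(2)}\,y\,S^{-1}(x_{(1)})$ for the two adjoint actions. On $\mathbb C[[h]]$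 let $\sim:\lambda\mapsto\tilde\lambda$ be the ring automorphism $h\mapsto-h$. An additive map $\phi$ of $\mathbb C[[h]]$-modules is $q$-linear if $\phi(\lambda a)=\tilde\lambda\,\phi(a)$; an algebra $q$-(anti-)isomorphism is a bijective $q$-linear map that respects (reverses) products; a Hopf algebra $q$-isomorphism is an algebra $q$-isomorphism $\phi$ that also satisfies $\Delta\cdot\phi=(\phi\otimes\phi)\cdot\Delta$, $\epsilon\cdot\phi={\sim}\cdot\epsilon$ and $S\cdot\phi=\phi\cdot S$, with the structure maps of source and target. Let $q$-conjugation $\sim:U_h(g)\to U_h(g)$, $a\mapsto\tilde a$, be the $q$-linear unital algebra homomorphism that fixes all generators $h_i,x_i^\pm$. Let $U_h(g)^{\rm op}$ be the algebra $U_h(g)$ with comultiplication $\Delta^T$, counit $\epsilon$ and antipode $S^{-1}$. Put $\tilde\theta={\sim}\cdot\theta$ and $\tilde S={\sim}\cdot S$. Then the maps $\Delta,\epsilon,S,\theta$ and $\sim$ exist and are uniquely determined by these requirements, and: (a) $\sim:U_h(g)\to U_h(g)^{\rm op}$ is a Hopf algebra $q$-isomorphism; in particular $\epsilon\cdot{\sim}={\sim}\cdot\epsilon$,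 $\Delta\cdot{\sim}=({\sim}\otimes{\sim})\cdot\Delta^T$, $S\cdot{\sim}={\sim}\cdot S^{-1}$. (b) $\tilde a\bullet\tilde b=\widetilde{a\circ b}$ for all $a,b\in U_h(g)$. (c) $\tilde\theta:U_h(g)\to U_h(g)$ is a Hopf algebra $q$-isomorphism, and $\tilde\theta(a)\circ\tilde\theta(b)=\tilde\theta(a\circ b)$ for all $a,b\in U_h(g)$. (d) $\tilde S:U_h(g)\to U_h(g)$ is an algebra $q$-anti-isomorphism, and $\tilde S(a)\circ\tilde S(b)=\tilde S(S^{-1}(a)\circ b)$ for all $a,b\in U_h(g)$. -/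

import Mathlib

open scoped PowerSeries TensorProduct

noncomputable section

/-! ## `q`-conjugation on `ℂ⟦h⟧` and the elements `q = e^h` -/

namespace QuantumGroup

/-- `q`-conjugation on `ℂ⟦h⟧`: the ring automorphism `f(h) ↦ f(-h)`. -/
def qconj : ℂ⟦X⟧ →+* ℂ⟦X⟧ := PowerSeries.rescale (-1)

/-- `q ^ c = e^{c h} ∈ ℂ⟦h⟧`. -/
def qpow (c : ℂ) : ℂ⟦X⟧ := PowerSeries.rescale c (PowerSeries.exp ℂ)

/-- Division by the central variable `h`, discarding the constant term. -/
def divX {A : Type*} [Ring A] (f : A⟦X⟧) : A⟦X⟧ :=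
  PowerSeries.mk fun n => PowerSeries.coeff (n + 1) f

/-- The symmetric quantum integer `[n]_{q^d} = ∑_{j < n} q^{d (n - 1 - 2 j)}`. -/
def qInt (d n : ℕ) : ℂ⟦X⟧ :=
  ∑ j ∈ Finset.range n, qpow ((d : ℂ) * ((n : ℂ) - 1 - 2 * (j : ℂ)))

/-- The quantum factorial `[n]_{q^d}!`. -/
def qFactorial (d n : ℕ) : ℂ⟦X⟧ := ∏ m ∈ Finset.range n, qInt d (m + 1)

/-- The quantum binomial coefficient in `q^d`, for `k ≤ n`. (The denominator is a unit.) -/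
def qBinom (d n k : ℕ) : ℂ⟦X⟧ :=
  qFactorial d n * (qFactorial d k * qFactorial d (n - k))⁻¹

/-! ## The quantized enveloping algebra attached to a Cartan matrix -/

/-- The generators `h_i` and `x_i^±`; the sign is recorded by a unit of `ℤ`. -/
inductive Gen (ι : Type*)
  | h : ι → Gen ι
  | x : ℤˣ → ι → Gen ι

/-- `ℂ⟨h_i, x_i^±⟩⟦h⟧`, power series in a central variable `h` over the free algebra, i.e. the
`h`-adic completion of the free `ℂ⟦h⟧`-algebra. -/
abbrev FreeSeries (ι : Type*) := PowerSeries (FreeAlgebra ℂ (Gen ι))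

instance FreeSeries.algebra (ι : Type*) : Algebra ℂ⟦X⟧ (FreeSeries ι) :=
  (PowerSeries.map (algebraMap ℂ (FreeAlgebra ℂ (Gen ι)))).toAlgebra' (by
    intro c f
    ext n
    rw [PowerSeries.coeff_mul, PowerSeries.coeff_mul, ← Finset.Nat.sum_antidiagonal_swap]
    refine Finset.sum_congr rfl fun p _ => ?_
    simp [Algebra.commutes])

namespace FreeSeries

variable {ι : Type*}

def gh (i : ι) : FreeSeries ι := PowerSeries.C (FreeAlgebra.ι ℂ (Gen.h i))

def gx (s : ℤˣ) (i : ι) : FreeSeries ι := PowerSeries.C (FreeAlgebra.ι ℂ (Gen.x s i))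

/-- `q ^ (c h_i) = e^{c h h_i} = ∑ₙ (cⁿ / n!) h_iⁿ hⁿ`. -/
def qpowH (c : ℂ) (i : ι) : FreeSeries ι :=
  PowerSeries.mk fun n => (c ^ n / (n.factorial : ℂ)) • (FreeAlgebra.ι ℂ (Gen.h i)) ^ n

/-- The element `(q_i^{h_i} - q_i^{-h_i}) / (q_i - q_i⁻¹)`, where `q_i = q^d`. Numerator and
denominator are divisible by `h`; after dividing both by `h` the denominator is a unit
of `ℂ⟦h⟧` (for `d ≠ 0`). -/
def bracketH (d : ℕ) (i : ι) : FreeSeries ι :=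
  (divX (qpow d - qpow (-d)))⁻¹ • divX (qpowH (d : ℂ) i - qpowH (-(d : ℂ)) i)

theorem X_smul_divX {ι : Type*} (f : FreeSeries ι) (hf : PowerSeries.constantCoeff f = 0) :
    (PowerSeries.X : ℂ⟦X⟧) • divX f = f := by
  rw [Algebra.smul_def]
  change PowerSeries.map _ PowerSeries.X * _ = _
  rw [PowerSeries.map_X]
  ext n
  cases n with
  | zero => simp [hf]
  | succ n => simp [PowerSeries.coeff_succ_X_mul, divX]

theorem X_mul_divX (f : ℂ⟦X⟧) (hf : PowerSeries.constantCoeff f = 0) :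
    PowerSeries.X * divX f = f := by
  ext n
  cases n with
  | zero => simp [hf]
  | succ n => simp [PowerSeries.coeff_succ_X_mul, divX]

/-- `bracketH` is indeed the quotient of `q_i^{h_i} - q_i^{-h_i}` by `q_i - q_i⁻¹`. -/
theorem bracket_spec {ι : Type*} (d : ℕ) (hd : d ≠ 0) (i : ι) :
    (qpow d - qpow (-d)) • bracketH d i = qpowH (d : ℂ) i - qpowH (-(d : ℂ)) i := by
  have h1 : PowerSeries.constantCoeff (qpow d - qpow (-d)) = 0 := by
    rw [← PowerSeries.coeff_zero_eq_constantCoeff_apply, map_sub]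
    simp only [qpow, PowerSeries.coeff_rescale]
    simp
  have h2 : PowerSeries.constantCoeff (divX (qpow d - qpow (-d))) ≠ 0 := by
    rw [← PowerSeries.coeff_zero_eq_constantCoeff_apply]
    simp [-PowerSeries.coeff_zero_eq_constantCoeff, qpow, divX, PowerSeries.coeff_rescale, ← two_mul, hd]
  have h3 : PowerSeries.constantCoeff (qpowH (d : ℂ) i - qpowH (-(d : ℂ)) i) = 0 := by
    rw [← PowerSeries.coeff_zero_eq_constantCoeff_apply]
    simp [qpowH]
  conv_lhs => rw [← X_mul_divX _ h1]
  rw [bracketH, smul_smul, mul_assoc, PowerSeries.mul_inv_cancel _ h2, mul_one, X_smul_divX _ h3]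

theorem X_pow_mul' {ι : Type*} (n : ℕ) (f : FreeSeries ι) :
    (PowerSeries.X : ℂ⟦X⟧) ^ n • f = PowerSeries.X ^ n * f := by
  rw [Algebra.smul_def]
  change PowerSeries.map _ (PowerSeries.X ^ n) * _ = _
  rw [map_pow, PowerSeries.map_X]

theorem exists_X_pow_mul {ι : Type*} (n : ℕ) (f : FreeSeries ι)
    (hf : ∀ k < n, PowerSeries.coeff k f = 0) :
    ∃ r : FreeSeries ι, f = PowerSeries.X ^ n * r := by
  refine ⟨PowerSeries.mk fun k => PowerSeries.coeff (k + n) f, ?_⟩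
  ext k
  rw [PowerSeries.coeff_X_pow_mul']
  split_ifs with h
  · simp [Nat.sub_add_cancel h]
  · exact hf k (by omega)

/-- The left-hand side of the quantum Serre relation for `x_i^s`, `x_j^s`, with `N = 1 - a_{ij}`. -/
def serre (a : ι → ι → ℤ) (d : ι → ℕ) (s : ℤˣ) (i j : ι) : FreeSeries ι :=
  let N : ℕ := (1 - a i j).toNat
  ∑ k ∈ Finset.range (N + 1),
    ((-1 : ℂ⟦X⟧) ^ k * qBinom (d i) N k) • (gx s i ^ k * gx s j * gx s i ^ (N - k))

/-- The defining relations, as elements that have to vanish. -/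
inductive Rel (a : ι → ι → ℤ) (d : ι → ℕ) : FreeSeries ι → Prop
  | hh (i j : ι) : Rel a d (gh i * gh j - gh j * gh i)
  | hx (s : ℤˣ) (i j : ι) :
      Rel a d (gh i * gx s j - gx s j * gh i - ((s : ℤ) * a i j) • gx s j)
  | xx (i : ι) : Rel a d (gx 1 i * gx (-1) i - gx (-1) i * gx 1 i - bracketH (d i) i)
  | xx_ne (i j : ι) (hij : i ≠ j) : Rel a d (gx 1 i * gx (-1) j - gx (-1) j * gx 1 i)
  | serre (s : ℤˣ) (i j : ι) (hij : i ≠ j) : Rel a d (serre a d s i j)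

/-- The `h`-adic closure `⋂ₙ (I + hⁿ ℂ⟨h_i, x_i^±⟩⟦h⟧)` of the two-sided ideal `I` generated by
the relations. -/
def relIdeal (a : ι → ι → ℤ) (d : ι → ℕ) : TwoSidedIdeal (FreeSeries ι) :=
  ⨅ n : ℕ, TwoSidedIdeal.span ({r | Rel a d r} ∪ {PowerSeries.X ^ n})

end FreeSeries

/-- The quantized enveloping algebra `U_h` attached to a matrix `a` (with symmetrizing integers
`d`): the `ℂ⟦h⟧`-algebra topologically generated by `h_i`, `x_i^±` with the defining relations. -/
def Uh {ι : Type*} (a : ι → ι → ℤ) (d : ι → ℕ) : Type _ :=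
  FreeSeries ι ⧸ (FreeSeries.relIdeal a d).asIdeal

namespace Uh

variable {ι : Type*} (a : ι → ι → ℤ) (d : ι → ℕ)

instance : Ring (Uh a d) :=
  inferInstanceAs (Ring (FreeSeries ι ⧸ (FreeSeries.relIdeal a d).asIdeal))

instance : Algebra ℂ⟦X⟧ (Uh a d) :=
  inferInstanceAs (Algebra ℂ⟦X⟧ (FreeSeries ι ⧸ (FreeSeries.relIdeal a d).asIdeal))

/-- The quotient map. -/
def mk : FreeSeries ι →ₐ[ℂ⟦X⟧] Uh a d :=
  Ideal.Quotient.mkₐ ℂ⟦X⟧ (FreeSeries.relIdeal a d).asIdeal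

/-- The generator `h_i`. -/
def h (i : ι) : Uh a d := mk a d (FreeSeries.gh i)

/-- The generator `x_i^s`, `s = ±1`. -/
def x (s : ℤˣ) (i : ι) : Uh a d := mk a d (FreeSeries.gx s i)

/-- The element `q_i^{c h_i}` with `q_i = q^{d_i}`. -/
def qh (c : ℂ) (i : ι) : Uh a d := mk a d (FreeSeries.qpowH (c * (d i : ℂ)) i)

end Uh

/-! ## The `h`-adic topology and completed tensor products -/

section Adic

variable (B : Type*) [Ring B] [Algebra ℂ⟦X⟧ B]

/-- The subgroup `hⁿ B`. -/
def hPow (n : ℕ) : AddSubgroup B :=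
  (DistribSMul.toAddMonoidHom B ((PowerSeries.X : ℂ⟦X⟧) ^ n)).range

variable {B} in
theorem mem_hPow {n : ℕ} {y : B} :
    y ∈ hPow B n ↔ ∃ b : B, (PowerSeries.X : ℂ⟦X⟧) ^ n • b = y := Iff.rfl

theorem hPow_basis : RingSubgroupsBasis (hPow B) where
  inter i j := by
    refine ⟨i + j, fun y hy => ?_⟩
    obtain ⟨b, rfl⟩ := mem_hPow.1 hy
    exact ⟨mem_hPow.2 ⟨(PowerSeries.X : ℂ⟦X⟧) ^ j • b, by rw [smul_smul, ← pow_add]⟩,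
      mem_hPow.2 ⟨(PowerSeries.X : ℂ⟦X⟧) ^ i • b, by rw [smul_smul, ← pow_add, add_comm]⟩⟩
  mul i := by
    refine ⟨i, ?_⟩
    rintro _ ⟨y, hy, z, hz, rfl⟩
    obtain ⟨b, rfl⟩ := mem_hPow.1 hy
    exact mem_hPow.2 ⟨b * z, by simp⟩
  leftMul y i := by
    refine ⟨i, fun z hz => ?_⟩
    obtain ⟨b, rfl⟩ := mem_hPow.1 hz
    exact mem_hPow.2 ⟨y * b, by simp⟩
  rightMul y i := by
    refine ⟨i, fun z hz => ?_⟩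
    obtain ⟨b, rfl⟩ := mem_hPow.1 hz
    exact mem_hPow.2 ⟨b * y, by simp⟩

/-- The `h`-adic topology. -/
@[reducible] def hTopology : TopologicalSpace B := (hPow_basis B).topology

theorem hTopology_isTopologicalRing : @IsTopologicalRing B (hTopology B) _ :=
  (hPow_basis B).toRingFilterBasis.isTopologicalRing

/-- The uniform structure of the `h`-adic topology. -/
@[reducible] def hUniformSpace : UniformSpace B :=
  letI := hTopology B
  haveI := hTopology_isTopologicalRing B
  IsTopologicalAddGroup.rightUniformSpace B

end Adic

namespace Uh

variable {ι : Type*} (a : ι → ι → ℤ) (d : ι → ℕ)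

instance : UniformSpace (Uh a d) := hUniformSpace _

theorem mk_surj : Function.Surjective (mk a d) := Ideal.Quotient.mk_surjective

theorem hPow_sep {y : Uh a d} (hy : ∀ n, y ∈ hPow (Uh a d) n) : y = 0 := by
  obtain ⟨p, rfl⟩ := mk_surj a d y
  refine Ideal.Quotient.eq_zero_iff_mem.2 ?_
  rw [TwoSidedIdeal.mem_asIdeal, FreeSeries.relIdeal, TwoSidedIdeal.mem_iInf]
  intro n
  obtain ⟨b, hb⟩ := mem_hPow.1 (hy n)
  obtain ⟨r, rfl⟩ := mk_surj a d b
  rw [← map_smul] at hb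
  have h1 := Ideal.Quotient.eq.1 hb
  rw [TwoSidedIdeal.mem_asIdeal, FreeSeries.relIdeal, TwoSidedIdeal.mem_iInf] at h1
  have h2 := h1 n
  have h3 : (PowerSeries.X : ℂ⟦X⟧) ^ n • r ∈
      TwoSidedIdeal.span ({r | FreeSeries.Rel a d r} ∪ {(PowerSeries.X ^ n : FreeSeries ι)}) := by
    rw [FreeSeries.X_pow_mul']
    exact TwoSidedIdeal.mul_mem_right _ _ _ (TwoSidedIdeal.subset_span (by simp))
  simpa using TwoSidedIdeal.sub_mem _ h3 h2
instance : IsTopologicalRing (Uh a d) := hTopology_isTopologicalRing _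
instance : IsUniformAddGroup (Uh a d) := isUniformAddGroup_of_addCommGroup
theorem basis0 : (nhds (0 : Uh a d)).HasBasis (fun _ => True) fun n => (hPow (Uh a d) n : Set _) :=
  (hPow_basis (Uh a d)).hasBasis_nhds_zero
/-! `U_h` is separated and complete in the `h`-adic topology. -/

instance : T0Space (Uh a d) := by
  have : T2Space (Uh a d) := by
    refine IsTopologicalAddGroup.t2Space_of_zero_sep ?_
    intro y hy
    by_contra! hc
    exact hy (hPow_sep a d fun n => hc _ ((basis0 a d).mem_of_mem trivial))
  infer_instance
instance : CompleteSpace (Uh a d) := by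
  have : (nhds (0 : Uh a d)).IsCountablyGenerated := (basis0 a d).isCountablyGenerated
  have : (uniformity (Uh a d)).IsCountablyGenerated := IsUniformAddGroup.uniformity_countably_generated
  refine UniformSpace.complete_of_convergent_controlled_sequences
    (fun n => {p : Uh a d × Uh a d | p.2 - p.1 ∈ hPow (Uh a d) n}) (fun n => ?_) fun u hu => ?_
  · rw [uniformity_eq_comap_nhds_zero]
    exact ⟨_, (basis0 a d).mem_of_mem trivial, fun p hp => hp⟩
  · have h1 : ∀ n, ∃ p : FreeSeries ι, mk a d (PowerSeries.X ^ n * p) = u (n+1) - u n := fun n => by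
      obtain ⟨b, hb⟩ := mem_hPow.1 (hu n n (n+1) le_rfl n.le_succ)
      obtain ⟨r, rfl⟩ := mk_surj a d b
      exact ⟨r, by rw [← FreeSeries.X_pow_mul', map_smul]; exact hb⟩
    choose p hp using h1
    obtain ⟨p0, hp0⟩ := mk_surj a d (u 0)
    set P : FreeSeries ι := PowerSeries.mk fun k =>
      ∑ j ∈ Finset.range (k + 1), PowerSeries.coeff (k - j) (p j) with hP
    have h2 : ∀ n, ∃ r : FreeSeries ι,
        P = (∑ j ∈ Finset.range n, PowerSeries.X ^ j * p j) + PowerSeries.X ^ n * r := by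
      intro n
      obtain ⟨r, hr⟩ := FreeSeries.exists_X_pow_mul n
        (P - ∑ j ∈ Finset.range n, PowerSeries.X ^ j * p j) (by
          intro k hk
          rw [map_sub, hP, PowerSeries.coeff_mk, map_sum, sub_eq_zero]
          rw [← Finset.sum_subset (s₁ := Finset.range (k + 1)) (s₂ := Finset.range n)]
          · refine Finset.sum_congr rfl fun j hj => ?_
            rw [PowerSeries.coeff_X_pow_mul', if_pos (by simp at hj; omega)]
          · intro j; simp; omega
          · intro j _ hj
            rw [PowerSeries.coeff_X_pow_mul', if_neg (by simp at hj; omega)])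
      exact ⟨r, by rw [← hr]; abel⟩
    have h3 : ∀ n, u n = mk a d (p0 + ∑ j ∈ Finset.range n, PowerSeries.X ^ j * p j) := by
      intro n
      induction n with
      | zero => simp [hp0]
      | succ n ih =>
        rw [Finset.sum_range_succ, ← add_assoc, map_add, ← ih, hp]
        abel
    refine ⟨mk a d (p0 + P), ?_⟩
    rw [((hPow_basis (Uh a d)).hasBasis_nhds (mk a d (p0 + P))).tendsto_right_iff]
    intro n _
    filter_upwards [Filter.eventually_ge_atTop n] with m hm
    obtain ⟨r, hr⟩ := h2 m
    refine mem_hPow.2 ⟨mk a d (-(PowerSeries.X ^ (m - n) * r)), ?_⟩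
    rw [← map_smul, h3 m, ← map_sub]
    congr 1
    rw [FreeSeries.X_pow_mul', hr, mul_neg, ← mul_assoc, ← pow_add, Nat.add_sub_cancel' hm]
    abel

/-- The algebraic tensor square `U_h ⊗ U_h` over `ℂ⟦h⟧`, to be completed `h`-adically. -/
abbrev Tensor := Uh a d ⊗[ℂ⟦X⟧] Uh a d

instance : UniformSpace (Tensor a d) := hUniformSpace _

instance : IsTopologicalRing (Tensor a d) := hTopology_isTopologicalRing _

instance : IsUniformAddGroup (Tensor a d) := isUniformAddGroup_of_addCommGroup

instance : UniformContinuousConstSMul ℂ⟦X⟧ (Tensor a d) where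
  uniformContinuous_const_smul c := by
    have : (fun t : Tensor a d => c • t) = fun t => algebraMap ℂ⟦X⟧ (Tensor a d) c * t := by
      funext t; rw [Algebra.smul_def]
    rw [this]
    exact uniformContinuous_addMonoidHom_of_continuous
      (f := AddMonoidHom.mulLeft (algebraMap ℂ⟦X⟧ (Tensor a d) c)) (continuous_const_mul _)

/-- The completed tensor product: the `h`-adic completion of `U_h ⊗ U_h`. -/
abbrev CTensor := UniformSpace.Completion (Tensor a d)

variable {a d}

/-- `y ⊗ z` in the completed tensor product. -/
def ctmul (y z : Uh a d) : CTensor a d := ((y ⊗ₜ[ℂ⟦X⟧] z : Tensor a d) : CTensor a d)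

/-- The flip of the two tensor factors. -/
def flip : CTensor a d → CTensor a d :=
  UniformSpace.Completion.map (TensorProduct.comm ℂ⟦X⟧ (Uh a d) (Uh a d))

/-- `φ ⊗ φ` on the completed tensor product, for a linear or `q`-linear `φ`. -/
def tmap {σ : ℂ⟦X⟧ →+* ℂ⟦X⟧} (φ : Uh a d →ₛₗ[σ] Uh a d) : CTensor a d → CTensor a d :=
  UniformSpace.Completion.map (TensorProduct.map φ φ)

/-! ## The structure maps of the quantum group -/

/-- The comultiplication. -/
structure IsComul (Δ : Uh a d →ₐ[ℂ⟦X⟧] CTensor a d) : Prop where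
  map_h (i : ι) : Δ (h a d i) = ctmul (h a d i) 1 + ctmul 1 (h a d i)
  map_x (s : ℤˣ) (i : ι) :
    Δ (x a d s i) = ctmul (x a d s i) (qh a d (1 / 2) i) + ctmul (qh a d (-1 / 2) i) (x a d s i)

/-- The counit. -/
structure IsCounit (ε : Uh a d →ₐ[ℂ⟦X⟧] ℂ⟦X⟧) : Prop where
  map_h (i : ι) : ε (h a d i) = 0
  map_x (s : ℤˣ) (i : ι) : ε (x a d s i) = 0

/-- The antipode: the algebra anti-automorphism with `S(h_i) = -h_i`,
`S(x_i^±) = -q_i^{±1} x_i^±`. -/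
structure IsAntipode (S : Uh a d ≃ₗ[ℂ⟦X⟧] Uh a d) : Prop where
  map_one : S 1 = 1
  map_mul (y z : Uh a d) : S (y * z) = S z * S y
  map_h (i : ι) : S (h a d i) = -h a d i
  map_x (s : ℤˣ) (i : ι) :
    S (x a d s i) = -(qpow ((((s : ℤˣ) : ℤ) : ℂ) * (d i : ℂ)) • x a d s i)

/-- The Cartan involution. -/
structure IsCartanInvolution (θ : Uh a d →ₐ[ℂ⟦X⟧] Uh a d) : Prop where
  map_h (i : ι) : θ (h a d i) = -h a d i
  map_x (s : ℤˣ) (i : ι) : θ (x a d s i) = x a d (-s) i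

/-- An algebra `q`-isomorphism: a bijective `q`-linear map that respects products and units. -/
structure IsAlgQIso (φ : Uh a d →ₛₗ[qconj] Uh a d) : Prop where
  bijective : Function.Bijective φ
  map_one : φ 1 = 1
  map_mul (y z : Uh a d) : φ (y * z) = φ y * φ z

/-- An algebra `q`-anti-isomorphism. -/
structure IsAlgQAntiIso (φ : Uh a d →ₛₗ[qconj] Uh a d) : Prop where
  bijective : Function.Bijective φ
  map_one : φ 1 = 1
  map_mul (y z : Uh a d) : φ (y * z) = φ z * φ y

/-- `q`-conjugation on `U_h`: the algebra `q`-homomorphism fixing the generators. -/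
structure IsQConj (κ : Uh a d →ₛₗ[qconj] Uh a d) : Prop where
  map_one : κ 1 = 1
  map_mul (y z : Uh a d) : κ (y * z) = κ y * κ z
  map_h (i : ι) : κ (h a d i) = h a d i
  map_x (s : ℤˣ) (i : ι) : κ (x a d s i) = x a d s i

/-- `φ` is a Hopf algebra `q`-isomorphism from `U_h` with comultiplication, counit and antipode
`Δ₁, ε₁, S₁` to `U_h` with `Δ₂, ε₂, S₂` (the multiplication is that of `U_h` on both sides). -/
structure IsHopfQIso (Δ₁ : Uh a d → CTensor a d) (ε₁ : Uh a d → ℂ⟦X⟧) (S₁ : Uh a d → Uh a d)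
    (Δ₂ : Uh a d → CTensor a d) (ε₂ : Uh a d → ℂ⟦X⟧) (S₂ : Uh a d → Uh a d)
    (φ : Uh a d →ₛₗ[qconj] Uh a d) : Prop where
  isAlgQIso : IsAlgQIso φ
  comul (y : Uh a d) : Δ₂ (φ y) = tmap φ (Δ₁ y)
  counit (y : Uh a d) : ε₂ (φ y) = qconj (ε₁ y)
  antipode (y : Uh a d) : S₂ (φ y) = φ (S₁ y)

/-- The adjoint action `y ∘ z = ∑ y₍₁₎ z S(y₍₂₎)`: the continuous extension of
`u ⊗ v ↦ u z S(v)` to the completed tensor product, applied to `Δ(y)`. -/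
def ad (Δ : Uh a d →ₐ[ℂ⟦X⟧] CTensor a d) (S : Uh a d ≃ₗ[ℂ⟦X⟧] Uh a d) (y z : Uh a d) : Uh a d :=
  UniformSpace.Completion.extension
    (TensorProduct.lift ((LinearMap.mul ℂ⟦X⟧ (Uh a d)).compl₁₂
      (LinearMap.mulRight ℂ⟦X⟧ z) S.toLinearMap)) (Δ y)

/-- The second adjoint action `y • z = ∑ y₍₂₎ z S⁻¹(y₍₁₎)`. -/
def ad' (Δ : Uh a d →ₐ[ℂ⟦X⟧] CTensor a d) (S : Uh a d ≃ₗ[ℂ⟦X⟧] Uh a d) (y z : Uh a d) : Uh a d :=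
  UniformSpace.Completion.extension
    (TensorProduct.lift ((LinearMap.mul ℂ⟦X⟧ (Uh a d)).compl₁₂
      (LinearMap.mulRight ℂ⟦X⟧ z) S.symm.toLinearMap)) (flip (Δ y))

end Uh

/-! ## The quantum group of a simple Lie algebra -/

/-- The Cartan matrix `a_{ij} = 2 (α_i, α_j) / (α_i, α_i)` of a complex simple Lie algebra with
respect to a Cartan subalgebra and a base of simple roots. -/
def cartanMatrix {g : Type*} [LieRing g] [LieAlgebra ℂ g] [FiniteDimensional ℂ g]
    [LieAlgebra.IsSimple ℂ g] {H : LieSubalgebra ℂ g} [H.IsCartanSubalgebra]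
    (b : (LieAlgebra.IsKilling.rootSystem H).Base) (i j : b.support) : ℤ :=
  b.cartanMatrix j i

end QuantumGroup

end

noncomputable section

namespace QuantumGroup

/-! ## Rings that are separated and complete with respect to powers of `h` -/

/-! All maps in the theorem are fixed by their values on the generators, and all identities between
them are checked on generators. Two principles justify this. Let `R` be separated and complete for a
filtration by two-sided ideals `K n` containing `hⁿ R`. Then power series over `R` can be evaluated
at the central element `h` (`hEval`), so `e^{c h r}` and the Cartan bracket make sense in `R`. A
family in `R` satisfying the relations of `U_h` extends to `U_h` (`Uh.lift`): modulo each `K n` both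
the relations and `hⁿ` vanish, hence so does the `h`-adic closure of the relation ideal
(`map_relIdeal_eq_zero`). Conversely, two semilinear homomorphisms agreeing on generators differ by
something divisible by all powers of `h` (`Uh.ringHom_ext`). Antihomomorphisms are treated as
homomorphisms into the opposite ring.

Existence therefore amounts to checking relations. Conjugation comes from `h ↦ -h` on the free
series algebra, which fixes every relation because quantum binomials are symmetric in `q` and `q⁻¹`
and the bracket is a quotient of two odd expressions. The counit, `θ` and `S` need only the oddness
of the bracket and the homogeneity and reversal symmetry of the Serre sum. The substantial case is
`Δ`. The two summands of `Δ(x_i^s)` and `Δ(x_j^t)` commute up to a power of `q` (`coproduct_cross`).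
Opposite signs give exponent zero, so the cross terms of the commutator cancel. For equal signs the
Serre expression factors into `q`-commutators, and the exponents are exactly those for which all
mixed terms drop out (`serreTwist_succ`, `serreTwist_add`, `serreSum_add`).

For (a) to (d), each of conjugation, `θ` and `S` inverts `q_i^{c h_i}`. Conjugation alone therefore
turns `Δ` into its flip, whereas conjugation composed with `θ` or with `S` respects `Δ`. On scalars,
conjugation inverts `q_i`, which turns `S` into its inverse. The statements on adjoint actions
follow by applying the (anti)homomorphism to `u z S(v)`, first on pure tensors and then by
continuity (`Uh.sandwich_tmap`, `Uh.sandwich_tmap_anti`). -/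

theorem C_add_X_mul_divX {A : Type*} [Ring A] (p : A⟦X⟧) :
    PowerSeries.C (PowerSeries.coeff 0 p) + PowerSeries.X * divX p = p := by
  ext n
  cases n with
  | zero => simp
  | succ n => simp [PowerSeries.coeff_succ_X_mul, divX]

/-- A separated complete filtration by two-sided ideals `K n` with `hⁿ R ⊆ K n`. -/
structure IsHFiltration (R : Type*) [Ring R] [Algebra ℂ⟦X⟧ R] (K : ℕ → AddSubgroup R) : Prop where
  anti (n : ℕ) : K (n + 1) ≤ K n
  pow_smul_mem (n : ℕ) (r : R) : (PowerSeries.X : ℂ⟦X⟧) ^ n • r ∈ K n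
  mul_mem_left (n : ℕ) (r s : R) : s ∈ K n → r * s ∈ K n
  mul_mem_right (n : ℕ) (r s : R) : r ∈ K n → r * s ∈ K n
  eq_zero (r : R) : (∀ n, r ∈ K n) → r = 0
  complete (u : ℕ → R) : (∀ n, u (n + 1) - u n ∈ K n) → ∃ L, ∀ n, L - u n ∈ K n

/-- `R` has a separated complete filtration that is compatible with the powers of `h`. -/
class IsHComplete (R : Type*) [Ring R] [Algebra ℂ⟦X⟧ R] : Prop where
  exists_filtration : ∃ K : ℕ → AddSubgroup R, IsHFiltration R K

section HComplete

variable {R : Type*} [Ring R] [Algebra ℂ⟦X⟧ R]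

/-- A family of elements each of which is `h` times a multiple of another member vanishes. -/
theorem eq_zero_of_forall_exists_X_smul [IsHComplete R] {T : Type*} (D : T → R)
    (hD : ∀ t, ∃ t' c, D t = ((PowerSeries.X : ℂ⟦X⟧) * c) • D t') (t : T) : D t = 0 := by
  obtain ⟨K, hK⟩ := IsHComplete.exists_filtration (R := R)
  refine hK.eq_zero _ fun n => ?_
  have : ∀ t, ∃ r, D t = (PowerSeries.X : ℂ⟦X⟧) ^ n • r := by
    induction n with
    | zero => exact fun t => ⟨D t, by simp⟩
    | succ n ih =>
      intro t
      obtain ⟨t', c, h⟩ := hD t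
      obtain ⟨r, hr⟩ := ih t'
      exact ⟨c • r, by rw [h, hr, smul_smul, smul_smul]; congr 1; ring⟩
  obtain ⟨r, hr⟩ := this t
  rw [hr]
  exact hK.pow_smul_mem n r

/-- The recursion expresses the value at a series through the value at its shift times `h`, so the
difference of two solutions is infinitely divisible by `h`. Evaluation at `h` is thereby
characterised without reference to limits. -/
theorem eq_of_shift [IsHComplete R] {A : Type*} [Ring A] {f g : A⟦X⟧ → R} {φ : A → R}
    (hf : ∀ p, f p = φ (PowerSeries.coeff 0 p) + (PowerSeries.X : ℂ⟦X⟧) • f (divX p))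
    (hg : ∀ p, g p = φ (PowerSeries.coeff 0 p) + (PowerSeries.X : ℂ⟦X⟧) • g (divX p)) : f = g := by
  funext p
  rw [← sub_eq_zero]
  refine eq_zero_of_forall_exists_X_smul (fun p => f p - g p) (fun p => ⟨divX p, 1, ?_⟩) p
  rw [hf p, hg p, mul_one, smul_sub]
  abel

variable (R) in
theorem exists_eval [IsHComplete R] : ∃ e : R⟦X⟧ → R, ∀ p,
    e p = PowerSeries.coeff 0 p + (PowerSeries.X : ℂ⟦X⟧) • e (divX p) := by
  obtain ⟨K, hK⟩ := IsHComplete.exists_filtration (R := R)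
  let S : R⟦X⟧ → ℕ → R := fun p n =>
    ∑ k ∈ Finset.range n, (PowerSeries.X : ℂ⟦X⟧) ^ k • PowerSeries.coeff k p
  have hS : ∀ p, ∃ L, ∀ n, L - S p n ∈ K n := fun p => by
    refine hK.complete _ fun n => ?_
    simp only [S, Finset.sum_range_succ, add_sub_cancel_left]
    exact hK.pow_smul_mem _ _
  choose e he using hS
  refine ⟨e, fun p => ?_⟩
  rw [← sub_eq_zero]
  refine hK.eq_zero _ fun n => ?_
  -- The partial sum of `p` with `n + 1` terms matches that of `divX p` with `n` terms, which is why
  -- the estimate for `p` is taken one level deeper and then weakened.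
  have h1 := hK.anti n (he p (n + 1))
  have h2 := hK.mul_mem_left n (algebraMap ℂ⟦X⟧ R PowerSeries.X) _ (he (divX p) n)
  rw [← Algebra.smul_def] at h2
  have h3 : S p (n + 1) = PowerSeries.coeff 0 p + (PowerSeries.X : ℂ⟦X⟧) • S (divX p) n := by
    simp only [S, Finset.sum_range_succ', Finset.smul_sum, smul_smul, ← pow_succ', divX,
      PowerSeries.coeff_mk, pow_zero, one_smul]
    abel
  have := (K n).sub_mem h1 h2
  rw [h3, smul_sub] at this
  convert this using 1
  abel

variable [IsHComplete R]

/-- The underlying function of `hEval`. -/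
def hEvalFun : R⟦X⟧ → R := (exists_eval R).choose

theorem hEvalFun_eq (p : R⟦X⟧) : hEvalFun p =
    PowerSeries.coeff 0 p + (PowerSeries.X : ℂ⟦X⟧) • hEvalFun (divX p) :=
  (exists_eval R).choose_spec p

theorem divX_add {A : Type*} [Ring A] (p q : A⟦X⟧) : divX (p + q) = divX p + divX q := by
  ext n; simp [divX]

theorem divX_mul {A : Type*} [Ring A] (p q : A⟦X⟧) :
    divX (p * q) = PowerSeries.C (PowerSeries.coeff 0 p) * divX q + divX p * q := by
  ext n
  have h : p * q = PowerSeries.C (PowerSeries.coeff 0 p) * q + PowerSeries.X * (divX p * q) := by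
    rw [← mul_assoc, ← add_mul, C_add_X_mul_divX]
  simp [h, divX, PowerSeries.coeff_succ_X_mul]

theorem divX_C {A : Type*} [Ring A] (r : A) : divX (PowerSeries.C r) = 0 := by
  ext n; simp [divX]

theorem divX_X_mul {A : Type*} [Ring A] (p : A⟦X⟧) : divX (PowerSeries.X * p) = p := by
  ext n; simp [divX, PowerSeries.coeff_succ_X_mul]

theorem hEvalFun_add (p q : R⟦X⟧) : hEvalFun (p + q) = hEvalFun p + hEvalFun q := by
  rw [← sub_eq_zero]
  refine eq_zero_of_forall_exists_X_smul
    (fun t : R⟦X⟧ × R⟦X⟧ => hEvalFun (t.1 + t.2) - (hEvalFun t.1 + hEvalFun t.2))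
    (fun t => ⟨(divX t.1, divX t.2), 1, ?_⟩) (p, q)
  dsimp only
  rw [hEvalFun_eq (t.1 + t.2), hEvalFun_eq t.1, hEvalFun_eq t.2, divX_add, map_add, mul_one,
    smul_sub, smul_add]
  abel

theorem hEvalFun_zero : hEvalFun (0 : R⟦X⟧) = 0 := by
  simpa using hEvalFun_add (0 : R⟦X⟧) 0

theorem hEvalFun_C (r : R) : hEvalFun (PowerSeries.C r) = r := by
  rw [hEvalFun_eq, divX_C, hEvalFun_zero]; simp

theorem hEvalFun_C_mul (r : R) (p : R⟦X⟧) :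
    hEvalFun (PowerSeries.C r * p) = r * hEvalFun p := by
  rw [← sub_eq_zero]
  refine eq_zero_of_forall_exists_X_smul
    (fun t : R⟦X⟧ => hEvalFun (PowerSeries.C r * t) - r * hEvalFun t)
    (fun t => ⟨divX t, 1, ?_⟩) p
  rw [hEvalFun_eq (PowerSeries.C r * t), hEvalFun_eq t, divX_mul, divX_C, zero_mul, add_zero]
  simp [mul_add, smul_sub]

/-- Multiplicativity uses that `h` is central. The left factor is peeled one coefficient at a time,
and the defect at `t` becomes `h` times the defect at `divX t`. -/
theorem hEvalFun_mul (p q : R⟦X⟧) : hEvalFun (p * q) = hEvalFun p * hEvalFun q := by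
  rw [← sub_eq_zero]
  refine eq_zero_of_forall_exists_X_smul
    (fun t : R⟦X⟧ => hEvalFun (t * q) - hEvalFun t * hEvalFun q)
    (fun t => ⟨divX t, 1, ?_⟩) p
  rw [hEvalFun_eq (t * q), hEvalFun_eq t, divX_mul, hEvalFun_add, hEvalFun_C_mul]
  have h : PowerSeries.coeff 0 t * hEvalFun q = PowerSeries.coeff 0 (t * q) +
      (PowerSeries.X : ℂ⟦X⟧) • (PowerSeries.coeff 0 t * hEvalFun (divX q)) := by
    rw [hEvalFun_eq q]; simp [mul_add]
  rw [add_mul, h, mul_one, smul_add, smul_sub, smul_mul_assoc]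
  abel

variable (R) in
/-- Evaluation of power series over `R` at the central variable `h`. -/
def hEval : R⟦X⟧ →+* R where
  toFun := hEvalFun
  map_zero' := hEvalFun_zero
  map_add' := hEvalFun_add
  map_one' := hEvalFun_C 1
  map_mul' := hEvalFun_mul

@[simp] theorem hEval_C (r : R) : hEval R (PowerSeries.C r) = r := hEvalFun_C r

theorem hEval_eq (p : R⟦X⟧) : hEval R p =
    PowerSeries.coeff 0 p + (PowerSeries.X : ℂ⟦X⟧) • hEval R (divX p) := hEvalFun_eq p

theorem hEval_X_mul (p : R⟦X⟧) :
    hEval R (PowerSeries.X * p) = (PowerSeries.X : ℂ⟦X⟧) • hEval R p := by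
  rw [hEval_eq, divX_X_mul]; simp

theorem divX_map {A B : Type*} [Ring A] [Ring B] (f : A →+* B) (p : A⟦X⟧) :
    divX (PowerSeries.map f p) = PowerSeries.map f (divX p) := by
  ext n; simp [divX]

/-- A ring homomorphism that sends the variable to `h` is an evaluation. -/
theorem map_eq_hEval {A : Type*} [Ring A] (G : A⟦X⟧ →+* R)
    (hG : ∀ p, G (PowerSeries.X * p) = (PowerSeries.X : ℂ⟦X⟧) • G p) (p : A⟦X⟧) :
    G p = hEval R (PowerSeries.map (G.comp PowerSeries.C) p) := by
  refine congrFun (eq_of_shift (f := G)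
    (g := fun p => hEval R (PowerSeries.map (G.comp PowerSeries.C) p))
    (φ := G.comp PowerSeries.C) (fun p => ?_) (fun p => ?_)) p
  · conv_lhs => rw [← C_add_X_mul_divX p, map_add, hG]
    rfl
  · rw [hEval_eq, divX_map, PowerSeries.coeff_map]

theorem commute_hEval {r : R} {p : R⟦X⟧} (h : ∀ n, Commute r (PowerSeries.coeff n p)) :
    Commute r (hEval R p) := by
  have h1 : Commute (PowerSeries.C r) p := by
    ext n
    simpa using (h n).eq
  simpa using h1.map (hEval R)

theorem hEval_algebraMap (c : ℂ⟦X⟧) :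
    hEval R (PowerSeries.map ((algebraMap ℂ⟦X⟧ R).comp PowerSeries.C) c) = algebraMap ℂ⟦X⟧ R c := by
  refine (map_eq_hEval (algebraMap ℂ⟦X⟧ R) (fun p => ?_) c).symm
  rw [map_mul, Algebra.smul_def]

end HComplete

/-! ## The universal property of `U_h` -/

section Universal

variable {R : Type*} [Ring R] [Algebra ℂ⟦X⟧ R]

/-- The series `e^{c r h}`. -/
def expSeries (c : ℂ) (r : R) : R⟦X⟧ :=
  PowerSeries.mk fun n => (PowerSeries.C (c ^ n / (n.factorial : ℂ)) : ℂ⟦X⟧) • r ^ n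

/-- The element `e^{c r h}` of `R`. -/
def hexp [IsHComplete R] (c : ℂ) (r : R) : R := hEval R (expSeries c r)

/-- The element `(q^{d r} - q^{-d r}) / (q^d - q^{-d})`. -/
def bracket [IsHComplete R] (d : ℕ) (r : R) : R :=
  (divX (qpow d - qpow (-d)))⁻¹ • hEval R (divX (expSeries (d : ℂ) r - expSeries (-(d : ℂ)) r))

/-- The quantum Serre expression. -/
def serreSum (d N : ℕ) (e y : R) : R :=
  ∑ k ∈ Finset.range (N + 1), ((-1 : ℂ⟦X⟧) ^ k * qBinom d N k) • (e ^ k * y * e ^ (N - k))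

variable {ι : Type*}

/-- The homomorphism from the free algebra with prescribed values on the generators. -/
def freeHom (f : Gen ι → R) : FreeAlgebra ℂ (Gen ι) →+* R :=
  letI : Algebra ℂ R := Algebra.compHom R (PowerSeries.C : ℂ →+* ℂ⟦X⟧)
  (FreeAlgebra.lift ℂ f).toRingHom

@[simp] theorem freeHom_ι (f : Gen ι → R) (g : Gen ι) : freeHom f (FreeAlgebra.ι ℂ g) = f g :=
  letI : Algebra ℂ R := Algebra.compHom R (PowerSeries.C : ℂ →+* ℂ⟦X⟧)
  FreeAlgebra.lift_ι_apply f g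

@[simp] theorem freeHom_algebraMap (f : Gen ι → R) (c : ℂ) :
    freeHom f (algebraMap ℂ _ c) = algebraMap ℂ⟦X⟧ R (PowerSeries.C c) :=
  letI : Algebra ℂ R := Algebra.compHom R (PowerSeries.C : ℂ →+* ℂ⟦X⟧)
  (FreeAlgebra.lift ℂ f).commutes c

theorem freeHom_smul (f : Gen ι → R) (c : ℂ) (z : FreeAlgebra ℂ (Gen ι)) :
    freeHom f (c • z) = (PowerSeries.C c : ℂ⟦X⟧) • freeHom f z := by
  rw [Algebra.smul_def, map_mul, freeHom_algebraMap, Algebra.smul_def]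

theorem FreeSeries.smul_eq (c : ℂ⟦X⟧) (p : FreeSeries ι) :
    c • p = PowerSeries.map (algebraMap ℂ (FreeAlgebra ℂ (Gen ι))) c * p :=
  Algebra.smul_def c p

theorem map_qpowH (f : Gen ι → R) (c : ℂ) (i : ι) :
    PowerSeries.map (freeHom f) (FreeSeries.qpowH c i) = expSeries c (f (Gen.h i)) := by
  ext n
  simp [FreeSeries.qpowH, expSeries, freeHom_smul]

variable [IsHComplete R]

/-- The homomorphism from the completed free algebra with prescribed values on the generators. -/
def seriesHom (f : Gen ι → R) : FreeSeries ι →+* R :=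
  (hEval R).comp (PowerSeries.map (freeHom f))

theorem seriesHom_apply (f : Gen ι → R) (p : FreeSeries ι) :
    seriesHom f p = hEval R (PowerSeries.map (freeHom f) p) := rfl

theorem seriesHom_smul (f : Gen ι → R) (c : ℂ⟦X⟧) (p : FreeSeries ι) :
    seriesHom f (c • p) = c • seriesHom f p := by
  rw [FreeSeries.smul_eq, map_mul, Algebra.smul_def, ← hEval_algebraMap, seriesHom_apply]
  congr 2
  ext n
  simp

@[simp] theorem seriesHom_gh (f : Gen ι → R) (i : ι) :
    seriesHom f (FreeSeries.gh i) = f (Gen.h i) := by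
  simp [seriesHom_apply, FreeSeries.gh]

@[simp] theorem seriesHom_gx (f : Gen ι → R) (s : ℤˣ) (i : ι) :
    seriesHom f (FreeSeries.gx s i) = f (Gen.x s i) := by
  simp [seriesHom_apply, FreeSeries.gx]

@[simp] theorem seriesHom_qpowH (f : Gen ι → R) (c : ℂ) (i : ι) :
    seriesHom f (FreeSeries.qpowH c i) = hexp c (f (Gen.h i)) := by
  rw [seriesHom_apply, map_qpowH, hexp]

@[simp] theorem seriesHom_bracketH (f : Gen ι → R) (d : ℕ) (i : ι) :
    seriesHom f (FreeSeries.bracketH d i) = bracket d (f (Gen.h i)) := by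
  rw [FreeSeries.bracketH, seriesHom_smul, seriesHom_apply, ← divX_map, map_sub, map_qpowH,
    map_qpowH, bracket]

theorem seriesHom_serre (f : Gen ι → R) (a : ι → ι → ℤ) (d : ι → ℕ) (s : ℤˣ) (i j : ι) :
    seriesHom f (FreeSeries.serre a d s i j) =
      serreSum (d i) (1 - a i j).toNat (f (Gen.x s i)) (f (Gen.x s j)) := by
  simp [FreeSeries.serre, serreSum, seriesHom_smul]

/-- The family `f` satisfies the defining relations of `U_h`. -/
structure SatisfiesRel (a : ι → ι → ℤ) (d : ι → ℕ) (f : Gen ι → R) : Prop where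
  hh (i j : ι) : f (Gen.h i) * f (Gen.h j) = f (Gen.h j) * f (Gen.h i)
  hx (s : ℤˣ) (i j : ι) : f (Gen.h i) * f (Gen.x s j) - f (Gen.x s j) * f (Gen.h i) =
    ((s : ℤ) * a i j) • f (Gen.x s j)
  xx (i : ι) : f (Gen.x 1 i) * f (Gen.x (-1) i) - f (Gen.x (-1) i) * f (Gen.x 1 i) =
    bracket (d i) (f (Gen.h i))
  xx_ne (i j : ι) (hij : i ≠ j) :
    f (Gen.x 1 i) * f (Gen.x (-1) j) = f (Gen.x (-1) j) * f (Gen.x 1 i)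
  serre (s : ℤˣ) (i j : ι) (hij : i ≠ j) :
    serreSum (d i) (1 - a i j).toNat (f (Gen.x s i)) (f (Gen.x s j)) = 0

variable {a : ι → ι → ℤ} {d : ι → ℕ}

theorem SatisfiesRel.seriesHom_eq_zero {f : Gen ι → R} (hf : SatisfiesRel a d f)
    {r : FreeSeries ι} (hr : FreeSeries.Rel a d r) : seriesHom f r = 0 := by
  cases hr with
  | hh i j => simp [hf.hh i j]
  | hx s i j => rw [map_sub, map_sub, map_mul, map_mul, map_zsmul, sub_eq_zero]; simpa using hf.hx s i j
  | xx i => rw [map_sub, map_sub, map_mul, map_mul, sub_eq_zero]; simpa using hf.xx i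
  | xx_ne i j hij => rw [map_sub, map_mul, map_mul, sub_eq_zero]; simpa using hf.xx_ne i j hij
  | serre s i j hij => rw [seriesHom_serre, hf.serre s i j hij]

/-- Membership in the closure means that, for each `n`, `p` lies in the ideal generated by the
relations and `Xⁿ`. The former go to zero and the latter to `hⁿ cⁿ`, so `G p` lies in every `K n`.
The factor `c` covers both linear maps (`c = 1`) and `q`-linear ones (`c = -1`). -/
theorem map_relIdeal_eq_zero (G : FreeSeries ι →+* R) {c : ℂ⟦X⟧}
    (hX : G PowerSeries.X = algebraMap ℂ⟦X⟧ R (PowerSeries.X * c))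
    (hG : ∀ r, FreeSeries.Rel a d r → G r = 0) {p : FreeSeries ι}
    (hp : p ∈ FreeSeries.relIdeal a d) : G p = 0 := by
  obtain ⟨K, hK⟩ := IsHComplete.exists_filtration (R := R)
  refine hK.eq_zero _ fun n => ?_
  rw [FreeSeries.relIdeal, TwoSidedIdeal.mem_iInf] at hp
  have h := hp n
  clear hp
  induction h using TwoSidedIdeal.span_induction with
  | mem x hx =>
    rcases hx with hx | hx
    · rw [hG x hx]; exact (K n).zero_mem
    · rw [Set.mem_singleton_iff.1 hx, map_pow, hX, ← map_pow, mul_pow, map_mul,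
        ← Algebra.smul_def]
      exact hK.pow_smul_mem _ _
  | zero => rw [map_zero]; exact (K n).zero_mem
  | add x y _ _ hx hy => rw [map_add]; exact (K n).add_mem hx hy
  | neg x _ hx => rw [map_neg]; exact (K n).neg_mem hx
  | left_absorb z x _ hx => rw [map_mul]; exact hK.mul_mem_left _ _ _ hx
  | right_absorb z x _ hx => rw [map_mul]; exact hK.mul_mem_right _ _ _ hx

namespace Uh

theorem mk_eq_zero {p : FreeSeries ι} (hp : p ∈ FreeSeries.relIdeal a d) : mk a d p = 0 :=
  Ideal.Quotient.eq_zero_iff_mem.2 (TwoSidedIdeal.mem_asIdeal.2 hp)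

/-- Descent of a ring homomorphism to `U_h`. -/
def descend {B : Type*} [Ring B] (G : FreeSeries ι →+* B)
    (hG : ∀ p ∈ FreeSeries.relIdeal a d, G p = 0) : Uh a d →+* B :=
  Ideal.Quotient.lift (FreeSeries.relIdeal a d).asIdeal G
    fun p hp => hG p (TwoSidedIdeal.mem_asIdeal.1 hp)

theorem descend_mk {B : Type*} [Ring B] (G : FreeSeries ι →+* B)
    (hG : ∀ p ∈ FreeSeries.relIdeal a d, G p = 0) (p : FreeSeries ι) :
    descend G hG (mk a d p) = G p :=
  Ideal.Quotient.lift_mk _ _ _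

theorem seriesHom_X (f : Gen ι → R) :
    seriesHom f PowerSeries.X = algebraMap ℂ⟦X⟧ R (PowerSeries.X * 1) := by
  have := hEval_X_mul (1 : R⟦X⟧)
  rw [seriesHom_apply, PowerSeries.map_X, mul_one]
  rw [mul_one, map_one] at this
  rw [this, Algebra.smul_def, mul_one]

theorem seriesHom_relIdeal {f : Gen ι → R} (hf : SatisfiesRel a d f) (p : FreeSeries ι)
    (hp : p ∈ FreeSeries.relIdeal a d) : seriesHom f p = 0 :=
  map_relIdeal_eq_zero _ (seriesHom_X f) (fun _ => hf.seriesHom_eq_zero) hp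

/-- The algebra homomorphism on `U_h` with prescribed values on the generators. -/
def lift (f : Gen ι → R) (hf : SatisfiesRel a d f) : Uh a d →ₐ[ℂ⟦X⟧] R :=
  { descend (seriesHom f) (seriesHom_relIdeal hf) with
    commutes' := fun c => by
      have h : algebraMap ℂ⟦X⟧ (Uh a d) c = mk a d (c • 1) := by
        rw [map_smul, map_one, Algebra.algebraMap_eq_smul_one]
      rw [h]
      exact (descend_mk _ (seriesHom_relIdeal hf) _).trans
        (by rw [seriesHom_smul, map_one, Algebra.algebraMap_eq_smul_one]) }

theorem lift_mk (f : Gen ι → R) (hf : SatisfiesRel a d f) (p : FreeSeries ι) :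
    lift f hf (mk a d p) = seriesHom f p :=
  descend_mk _ (seriesHom_relIdeal hf) p

@[simp] theorem lift_h (f : Gen ι → R) (hf : SatisfiesRel a d f) (i : ι) :
    lift f hf (h a d i) = f (Gen.h i) := by
  rw [h, lift_mk, seriesHom_gh]

@[simp] theorem lift_x (f : Gen ι → R) (hf : SatisfiesRel a d f) (s : ℤˣ) (i : ι) :
    lift f hf (x a d s i) = f (Gen.x s i) := by
  rw [x, lift_mk, seriesHom_gx]

theorem mk_X_mul (p : FreeSeries ι) :
    mk a d (PowerSeries.X * p) = (PowerSeries.X : ℂ⟦X⟧) • mk a d p := by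
  rw [← map_smul, FreeSeries.smul_eq, PowerSeries.map_X]

theorem mk_C_algebraMap (c : ℂ) :
    mk a d (PowerSeries.C (algebraMap ℂ _ c)) = (PowerSeries.C c : ℂ⟦X⟧) • 1 := by
  rw [← map_one (mk a d), ← map_smul, FreeSeries.smul_eq, PowerSeries.map_C, mul_one]

/-- Two `σ`-linear ring homomorphisms on `U_h` that agree on the generators are equal. -/
theorem ringHom_ext {σ : ℂ⟦X⟧ →+* ℂ⟦X⟧} {c : ℂ⟦X⟧} (hσ : σ PowerSeries.X = PowerSeries.X * c)
    {φ ψ : Uh a d →+* R} (hφ : ∀ c y, φ (c • y) = σ c • φ y) (hψ : ∀ c y, ψ (c • y) = σ c • ψ y)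
    (hh : ∀ i, φ (h a d i) = ψ (h a d i)) (hx : ∀ s i, φ (x a d s i) = ψ (x a d s i)) :
    φ = ψ := by
  have h0 : ∀ z : FreeAlgebra ℂ (Gen ι),
      φ (mk a d (PowerSeries.C z)) = ψ (mk a d (PowerSeries.C z)) := by
    intro z
    induction z using FreeAlgebra.induction with
    | grade0 c => rw [mk_C_algebraMap, hφ, hψ, map_one, map_one]
    | grade1 g =>
      cases g with
      | h i => exact hh i
      | x s i => exact hx s i
    | mul z w hz hw => rw [map_mul, map_mul, map_mul, map_mul, hz, hw]
    | add z w hz hw => rw [map_add, map_add, map_add, map_add, hz, hw]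
  ext y
  obtain ⟨p, rfl⟩ := mk_surj a d y
  rw [← sub_eq_zero]
  -- Constant coefficients contribute equally by `h0`, so the difference at `p` is `σ h = h c` times
  -- the difference at `divX p`.
  refine eq_zero_of_forall_exists_X_smul (fun p => φ (mk a d p) - ψ (mk a d p))
    (fun p => ⟨divX p, c, ?_⟩) p
  conv_lhs => rw [← C_add_X_mul_divX p]
  rw [map_add, map_add, map_add, h0, mk_X_mul, hφ, hψ, hσ, smul_sub]
  abel

theorem algHom_ext {φ ψ : Uh a d →ₐ[ℂ⟦X⟧] R}
    (hh : ∀ i, φ (h a d i) = ψ (h a d i)) (hx : ∀ s i, φ (x a d s i) = ψ (x a d s i)) :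
    φ = ψ := by
  have := ringHom_ext (σ := RingHom.id _) (c := 1) (φ := φ.toRingHom) (ψ := ψ.toRingHom)
    (by simp) (fun c y => map_smul φ c y) (fun c y => map_smul ψ c y) hh hx
  ext y
  exact congrArg (fun f : Uh a d →+* R => f y) this

end Uh


end Universal

/-! ## Exponentials and brackets -/

section Exp

variable {R : Type*} [Ring R] [Algebra ℂ⟦X⟧ R]

/-- Absorbing `c` into `r` reduces both addition laws, in `r` and in `c`, to the one for `c = 1`. -/
theorem expSeries_eq_one (c : ℂ) (r : R) :
    expSeries c r = expSeries 1 ((PowerSeries.C c : ℂ⟦X⟧) • r) := by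
  ext n
  simp only [expSeries, PowerSeries.coeff_mk, smul_pow, smul_smul, ← map_pow, ← map_mul]
  congr 2
  simp [div_eq_inv_mul]

theorem expSeries_one_add {r s : R} (h : Commute r s) :
    expSeries 1 (r + s) = expSeries 1 r * expSeries 1 s := by
  ext n
  simp only [expSeries, PowerSeries.coeff_mk, PowerSeries.coeff_mul, h.add_pow', one_pow,
    Finset.smul_sum, smul_mul_smul_comm, ← map_mul]
  refine Finset.sum_congr rfl fun p hp => ?_
  rw [← Nat.cast_smul_eq_nsmul ℂ⟦X⟧, smul_smul]
  congr 1
  rw [← map_natCast (PowerSeries.C : ℂ →+* ℂ⟦X⟧), ← map_mul]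
  congr 1
  rw [Finset.HasAntidiagonal.mem_antidiagonal] at hp
  rw [← hp, Nat.cast_add_choose]
  have h1 : ((p.1 + p.2).factorial : ℂ) ≠ 0 := by exact_mod_cast Nat.factorial_ne_zero _
  have h2 : (p.1.factorial : ℂ) ≠ 0 := by exact_mod_cast Nat.factorial_ne_zero _
  have h3 : (p.2.factorial : ℂ) ≠ 0 := by exact_mod_cast Nat.factorial_ne_zero _
  field_simp

theorem expSeries_add {r s : R} (h : Commute r s) (c : ℂ) :
    expSeries c (r + s) = expSeries c r * expSeries c s := by
  rw [expSeries_eq_one c (r + s), smul_add, expSeries_one_add ((h.smul_left _).smul_right _),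
    ← expSeries_eq_one, ← expSeries_eq_one]

theorem expSeries_add_left (c c' : ℂ) (r : R) :
    expSeries (c + c') r = expSeries c r * expSeries c' r := by
  rw [expSeries_eq_one, map_add, add_smul,
    expSeries_one_add (((Commute.refl r).smul_left _).smul_right _),
    ← expSeries_eq_one, ← expSeries_eq_one]

theorem expSeries_neg (c : ℂ) (r : R) : expSeries c (-r) = expSeries (-c) r := by
  rw [expSeries_eq_one, expSeries_eq_one (-c), map_neg, neg_smul, smul_neg]

theorem coeff_zero_expSeries (c : ℂ) (r : R) : PowerSeries.coeff 0 (expSeries c r) = 1 := by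
  simp [expSeries, -PowerSeries.coeff_zero_eq_constantCoeff]

theorem divX_expSeries_sub (c c' : ℂ) (r : R) :
    PowerSeries.X * divX (expSeries c r - expSeries c' r) = expSeries c r - expSeries c' r := by
  conv_rhs => rw [← C_add_X_mul_divX (expSeries c r - expSeries c' r), map_sub,
    coeff_zero_expSeries, coeff_zero_expSeries, sub_self, map_zero, zero_add]

/-- This is the twisted Leibniz rule `e^{r+s} - e^{-(r+s)} = (e^r - e^{-r}) e^s + e^{-r} (e^s -
e^{-s})`, divided by the variable. It gives `bracket_add`, hence the relation between `x_i^+` and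
`x_i^-` for the comultiplication. -/
theorem divX_expSeries_add {r s : R} (h : Commute r s) (c : ℂ) :
    divX (expSeries c (r + s) - expSeries (-c) (r + s)) =
      divX (expSeries c r - expSeries (-c) r) * expSeries c s +
        expSeries (-c) r * divX (expSeries c s - expSeries (-c) s) := by
  rw [← divX_X_mul (divX (expSeries c r - expSeries (-c) r) * expSeries c s +
        expSeries (-c) r * divX (expSeries c s - expSeries (-c) s)), mul_add, ← mul_assoc,
    divX_expSeries_sub, ← mul_assoc, (PowerSeries.commute_X (expSeries (-c) r)).symm.eq, mul_assoc,
    divX_expSeries_sub, expSeries_add h, expSeries_add h, sub_mul, mul_sub, sub_add_sub_cancel]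

theorem divX_neg {A : Type*} [Ring A] (p : A⟦X⟧) : divX (-p) = -divX p := by
  ext n; simp [divX]

variable {R' : Type*} [Ring R'] [Algebra ℂ⟦X⟧ R']

theorem map_expSeries (φ : R →ₐ[ℂ⟦X⟧] R') (c : ℂ) (r : R) :
    PowerSeries.map (φ : R →+* R') (expSeries c r) = expSeries c (φ r) := by
  ext n; simp [expSeries]

theorem map_serreSum (φ : R →ₐ[ℂ⟦X⟧] R') (d N : ℕ) (e y : R) :
    φ (serreSum d N e y) = serreSum d N (φ e) (φ y) := by
  simp [serreSum]

variable [IsHComplete R]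

theorem hexp_add {r s : R} (h : Commute r s) (c : ℂ) : hexp c (r + s) = hexp c r * hexp c s := by
  rw [hexp, expSeries_add h, map_mul, hexp, hexp]

theorem hexp_add_left (c c' : ℂ) (r : R) : hexp (c + c') r = hexp c r * hexp c' r := by
  rw [hexp, expSeries_add_left, map_mul, hexp, hexp]

theorem hexp_neg (c : ℂ) (r : R) : hexp c (-r) = hexp (-c) r := by
  rw [hexp, expSeries_neg, hexp]

theorem commute_hexp {x r : R} (h : Commute x r) (c : ℂ) : Commute x (hexp c r) :=
  commute_hEval fun n => by
    rw [expSeries, PowerSeries.coeff_mk]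
    exact (h.pow_right n).smul_right _

theorem hexp_algebraMap (c l : ℂ) :
    hexp c (algebraMap ℂ⟦X⟧ R (PowerSeries.C l)) = algebraMap ℂ⟦X⟧ R (qpow (c * l)) := by
  rw [← hEval_algebraMap (qpow (c * l)), hexp]
  refine congrArg (hEval R) (PowerSeries.ext fun n => ?_)
  simp only [expSeries, qpow, PowerSeries.coeff_mk, PowerSeries.coeff_map,
    PowerSeries.coeff_rescale, PowerSeries.coeff_exp, ← map_pow, Algebra.smul_def, ← map_mul,
    RingHom.comp_apply]
  congr 2
  simp [mul_pow]
  ring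

/-- The hypothesis says `r x = x (r + l)`. The same then holds for all powers, so `e^{c h r} x = x
e^{c h (r + l)}`, and the central summand `l` splits off as a scalar. -/
theorem hexp_mul_of_bracket {r x : R} {l : ℂ} (h : r * x - x * r = (PowerSeries.C l : ℂ⟦X⟧) • x)
    (c : ℂ) : hexp c r * x = qpow (c * l) • (x * hexp c r) := by
  have h1 : SemiconjBy x (r + algebraMap ℂ⟦X⟧ R (PowerSeries.C l)) r := by
    rw [SemiconjBy, mul_add, ← Algebra.commutes, ← Algebra.smul_def, ← h]
    abel
  have h2 : PowerSeries.C x * expSeries c (r + algebraMap ℂ⟦X⟧ R (PowerSeries.C l)) =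
      expSeries c r * PowerSeries.C x := by
    ext n
    rw [PowerSeries.coeff_C_mul, PowerSeries.coeff_mul_C, expSeries, expSeries,
      PowerSeries.coeff_mk, PowerSeries.coeff_mk, mul_smul_comm, smul_mul_assoc,
      (h1.pow_right n).eq]
  have h3 := congrArg (hEval R) h2
  rw [map_mul, map_mul, hEval_C] at h3
  change x * hexp c _ = hexp c r * x at h3
  rw [← h3, hexp_add (Algebra.commute_algebraMap_right _ _), hexp_algebraMap, ← Algebra.commutes,
    ← Algebra.smul_def, mul_smul_comm]

theorem bracket_add {r s : R} (h : Commute r s) (d : ℕ) :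
    bracket d (r + s) = bracket d r * hexp d s + hexp (-d) r * bracket d s := by
  rw [bracket, divX_expSeries_add h, map_add, map_mul, map_mul, smul_add, bracket, bracket,
    smul_mul_assoc, mul_smul_comm, hexp, hexp]

theorem bracket_neg (d : ℕ) (r : R) : bracket d (-r) = -bracket d r := by
  rw [bracket, expSeries_neg, expSeries_neg, neg_neg, bracket, ← smul_neg, ← map_neg, ← divX_neg,
    neg_sub]

variable [IsHComplete R']

/-- The composite `φ ∘ hEval` still turns the variable into `h`, hence is itself an evaluation by
`map_eq_hEval`. -/
theorem map_hEval (φ : R →ₐ[ℂ⟦X⟧] R') (p : R⟦X⟧) :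
    φ (hEval R p) = hEval R' (PowerSeries.map (φ : R →+* R') p) := by
  rw [← RingHom.coe_coe φ, ← RingHom.comp_apply, map_eq_hEval]
  · congr 3
    ext x
    simp
  · intro q
    simp [hEval_X_mul]

theorem map_hexp (φ : R →ₐ[ℂ⟦X⟧] R') (c : ℂ) (r : R) : φ (hexp c r) = hexp c (φ r) := by
  rw [hexp, map_hEval, map_expSeries, hexp]

theorem map_bracket (φ : R →ₐ[ℂ⟦X⟧] R') (d : ℕ) (r : R) : φ (bracket d r) = bracket d (φ r) := by
  rw [bracket, map_smul, map_hEval, ← divX_map, map_sub, map_expSeries, map_expSeries, bracket]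

end Exp

/-! ## Quantum binomial coefficients -/

theorem qpow_zero : qpow 0 = 1 := by
  ext n
  cases n <;> simp [qpow, PowerSeries.coeff_one]

theorem qpow_add (c c' : ℂ) : qpow (c + c') = qpow c * qpow c' :=
  (PowerSeries.exp_mul_exp_eq_exp_add c c').symm

theorem qInt_add (d m n : ℕ) :
    qInt d (m + n) = qpow (d * n) * qInt d m + qpow (-(d * m)) * qInt d n := by
  rw [qInt, Finset.sum_range_add, qInt, qInt, Finset.mul_sum, Finset.mul_sum]
  congr 1 <;> refine Finset.sum_congr rfl fun j _ => ?_ <;> rw [← qpow_add] <;> congr 1 <;>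
    push_cast <;> ring

theorem constantCoeff_qInt (d n : ℕ) : PowerSeries.constantCoeff (qInt d n) = n := by
  rw [← PowerSeries.coeff_zero_eq_constantCoeff_apply, qInt, map_sum]
  simp [qpow, PowerSeries.coeff_rescale, -PowerSeries.coeff_zero_eq_constantCoeff]

theorem constantCoeff_qFactorial_ne_zero (d n : ℕ) :
    PowerSeries.constantCoeff (qFactorial d n) ≠ 0 := by
  rw [qFactorial, map_prod, Finset.prod_ne_zero_iff]
  intro m _
  rw [constantCoeff_qInt]
  exact_mod_cast Nat.succ_ne_zero m

theorem qFactorial_ne_zero (d n : ℕ) : qFactorial d n ≠ 0 := fun h =>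
  constantCoeff_qFactorial_ne_zero d n (by rw [h, map_zero])

theorem qFactorial_succ (d n : ℕ) : qFactorial d (n + 1) = qFactorial d n * qInt d (n + 1) :=
  Finset.prod_range_succ _ _

theorem qBinom_mul (d n k : ℕ) :
    qBinom d n k * (qFactorial d k * qFactorial d (n - k)) = qFactorial d n := by
  rw [qBinom, mul_assoc, PowerSeries.inv_mul_cancel, mul_one]
  rw [map_mul]
  exact mul_ne_zero (constantCoeff_qFactorial_ne_zero _ _) (constantCoeff_qFactorial_ne_zero _ _)

theorem qBinom_zero (d n : ℕ) : qBinom d n 0 = 1 := by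
  refine mul_right_cancel₀ (qFactorial_ne_zero d n) ?_
  have := qBinom_mul d n 0
  simpa [qFactorial] using this

theorem qBinom_symm (d : ℕ) {n k : ℕ} (h : k ≤ n) : qBinom d n (n - k) = qBinom d n k := by
  rw [qBinom, qBinom, Nat.sub_sub_self h, mul_comm (qFactorial d k)]

theorem qBinom_self (d n : ℕ) : qBinom d n n = 1 := by
  rw [← qBinom_symm d le_rfl, Nat.sub_self, qBinom_zero]

/-- The sign `e` selects one of the two ways of splitting off `m` or `n` terms; keeping it free lets
the Pascal identity, and the Serre argument after it, treat both `x_i^+` and `x_i^-`. -/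
theorem qInt_sum_symm {d m n : ℕ} (e : ℤˣ) : qInt d (m + n) =
    qpow (((e : ℤ) : ℂ) * d * n) * qInt d m + qpow (-(((e : ℤ) : ℂ) * d * m)) * qInt d n := by
  rcases Int.units_eq_one_or e with rfl | rfl
  · simpa using qInt_add d m n
  · rw [add_comm m n, qInt_add, add_comm]; simp

/-- The Pascal identity for quantum binomial coefficients. -/
theorem qBinom_succ_succ (d : ℕ) (e : ℤˣ) {n k : ℕ} (h : k + 1 ≤ n) :
    qBinom d (n + 1) (k + 1) = qpow (((e : ℤ) : ℂ) * d * (k + 1)) * qBinom d n (k + 1) +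
      qpow (-(((e : ℤ) : ℂ) * d * (n - k))) * qBinom d n k := by
  obtain ⟨m, rfl⟩ := Nat.exists_eq_add_of_le' h
  have h1 := qBinom_mul d (m + (k + 1) + 1) (k + 1)
  have h2 := qBinom_mul d (m + (k + 1)) (k + 1)
  have h3 := qBinom_mul d (m + (k + 1)) k
  rw [show m + (k + 1) + 1 - (k + 1) = m + 1 by omega] at h1
  rw [show m + (k + 1) - (k + 1) = m by omega] at h2
  rw [show m + (k + 1) - k = m + 1 by omega] at h3
  have h4 : qInt d (m + (k + 1) + 1) = _ := (congrArg (qInt d) (by omega)).trans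
    (qInt_sum_symm (d := d) (m := m + 1) (n := k + 1) e)
  rw [qFactorial_succ d (m + (k + 1)), h4, qFactorial_succ d m] at h1
  rw [qFactorial_succ d m] at h3
  -- After multiplication by `[k+1]! [m+1]!` the identity is the splitting of `[m+k+2]` into `[m+1]`
  -- and `[k+1]` recorded in `h4`.
  refine mul_right_cancel₀ (mul_ne_zero (qFactorial_ne_zero d (k + 1)) (mul_ne_zero
    (qFactorial_ne_zero d m) fun h => ?_ : qFactorial d m * qInt d (m + 1) ≠ 0)) (h1.trans ?_)
  · have := constantCoeff_qInt d (m + 1)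
    rw [h, map_zero] at this
    exact Nat.cast_ne_zero.2 m.succ_ne_zero this.symm
  · rw [show ((m + (k + 1) : ℕ) : ℂ) - k = ((m + 1 : ℕ) : ℂ) by push_cast; ring, mul_add]
    rw [show ((k : ℂ) + 1) = ((k + 1 : ℕ) : ℂ) by push_cast; ring]
    conv_lhs => enter [1]; rw [← h2]
    conv_lhs => enter [2]; rw [← h3]
    rw [qFactorial_succ d k]
    ring

/-! ## The quantum Serre expression -/

section Serre

variable {R : Type*} [Ring R] [Algebra ℂ⟦X⟧ R]

/-- The coefficients of the quantum Serre expression, extended by zero. -/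
def serreCoeff (d N k : ℕ) : ℂ⟦X⟧ := if k ≤ N then (-1) ^ k * qBinom d N k else 0

theorem serreCoeff_succ_zero (d N : ℕ) : serreCoeff d (N + 1) 0 = serreCoeff d N 0 := by
  simp [serreCoeff, qBinom_zero]

/-- Extension by zero makes the signed Pascal identity valid for every `k`, so the sums below need
no boundary cases. -/
theorem serreCoeff_succ_succ (d N k : ℕ) (e : ℤˣ) : serreCoeff d (N + 1) (k + 1) =
    qpow (((e : ℤ) : ℂ) * d * (k + 1)) * serreCoeff d N (k + 1) -
      qpow (-(((e : ℤ) : ℂ) * d * (N - k))) * serreCoeff d N k := by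
  rcases lt_trichotomy k N with h | rfl | h
  · rw [serreCoeff, serreCoeff, serreCoeff, if_pos (by omega), if_pos (by omega),
      if_pos (by omega), qBinom_succ_succ d e h]
    ring
  · simp [serreCoeff, qBinom_self, qpow_zero, pow_succ]
  · simp [serreCoeff, h.not_ge, show ¬ k + 1 ≤ N by omega]

/-- The Serre expression with left multiplication rescaled by `q^c`. -/
def serreTwist (d N : ℕ) (c : ℂ) (e y : R) : R :=
  ∑ k ∈ Finset.range (N + 1), (serreCoeff d N k * qpow (c * k)) • (e ^ k * y * e ^ (N - k))

theorem serreTwist_zero (d N : ℕ) (e y : R) : serreTwist d N 0 e y = serreSum d N e y := by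
  refine Finset.sum_congr rfl fun k hk => ?_
  rw [serreCoeff, if_pos (by simpa [Nat.lt_succ_iff] using hk), zero_mul, qpow_zero, mul_one]

/-- With `L` and `R` the left and right multiplications by `e` and `v = s d`, this peels one factor
off the `q`-binomial formula `∑ (-1)^k [N,k] q^{ck} L^k R^{N-k} = ∏_{j<N} (R - q^{c + v(2j-N+1)}
L)`. The sign `s` decides from which end the factor is taken. -/
theorem serreTwist_succ (d N : ℕ) (s : ℤˣ) (c : ℂ) (e y : R) :
    serreTwist d (N + 1) c e y =
      serreTwist d N (c + ((s : ℤ) : ℂ) * d) e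
        (y * e - qpow (c - ((s : ℤ) : ℂ) * d * N) • (e * y)) := by
  set v : ℂ := ((s : ℤ) : ℂ) * d with hv
  have h1 : serreTwist d N (c + v) e (y * e - qpow (c - v * N) • (e * y)) =
      (∑ k ∈ Finset.range (N + 1),
        (serreCoeff d N k * qpow ((c + v) * k)) • (e ^ k * y * e ^ (N + 1 - k))) -
      ∑ k ∈ Finset.range (N + 1), (serreCoeff d N k * qpow ((c + v) * k) * qpow (c - v * N)) •
        (e ^ (k + 1) * y * e ^ (N - k)) := by
    rw [serreTwist, ← Finset.sum_sub_distrib]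
    refine Finset.sum_congr rfl fun k hk => ?_
    rw [mul_sub, sub_mul, smul_sub, mul_smul_comm, smul_mul_assoc, smul_smul]
    congr 2
    · rw [Nat.succ_sub (by simpa [Nat.lt_succ_iff] using hk), pow_succ']
      simp only [mul_assoc]
    · rw [pow_succ]; simp only [mul_assoc]
  rw [h1, serreTwist, Finset.sum_range_succ' _ (N + 1), Finset.sum_range_succ'
    (fun k => (serreCoeff d N k * qpow ((c + v) * k)) • (e ^ k * y * e ^ (N + 1 - k))) N]
  have h2 : ∑ k ∈ Finset.range N, (serreCoeff d N (k + 1) * qpow ((c + v) * (k + 1 : ℕ))) •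
        (e ^ (k + 1) * y * e ^ (N + 1 - (k + 1))) =
      ∑ k ∈ Finset.range (N + 1), (serreCoeff d N (k + 1) * qpow ((c + v) * (k + 1 : ℕ))) •
        (e ^ (k + 1) * y * e ^ (N + 1 - (k + 1))) := by
    rw [Finset.sum_range_succ]
    simp [serreCoeff]
  rw [h2, serreCoeff_succ_zero, add_sub_right_comm, ← Finset.sum_sub_distrib]
  congr 1
  · refine Finset.sum_congr rfl fun k hk => ?_
    rw [Nat.add_sub_add_right, ← sub_smul, serreCoeff_succ_succ d N k s, ← hv]
    congr 1
    have h3 : qpow ((c + v) * (k + 1 : ℕ)) = qpow (v * (k + 1)) * qpow (c * (k + 1 : ℕ)) := by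
      rw [← qpow_add]; congr 1; push_cast; ring
    have h4 : qpow (-(v * (N - k))) * qpow (c * (k + 1 : ℕ)) =
        qpow ((c + v) * k) * qpow (c - v * N) := by
      rw [← qpow_add, ← qpow_add]; congr 1; push_cast; ring
    rw [h3]
    linear_combination -serreCoeff d N k * h4
  · simp

/-- A `q`-commuting summand drops out of the Serre expression. -/
theorem serreTwist_add (d : ℕ) (s : ℤˣ) {A B : R}
    (hAB : A * B = qpow (2 * (((s : ℤ) : ℂ) * d)) • (B * A)) (N : ℕ) (c : ℂ) (y : R)
    (hy : y * B = qpow (c + ((s : ℤ) : ℂ) * d * (1 - N)) • (B * y)) :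
    serreTwist d N c (A + B) y = serreTwist d N c A y := by
  induction N generalizing c y with
  | zero => simp [serreTwist]
  | succ N ih =>
    have hy' : y * B = qpow (c - ((s : ℤ) : ℂ) * d * N) • (B * y) := by
      rw [hy]; congr 2; push_cast; ring
    rw [serreTwist_succ d N s, serreTwist_succ d N s c A]
    -- The factor peeled off is the `q`-commutator that annihilates `B` against `y`, so only `A`
    -- survives in it.
    have h : y * (A + B) - qpow (c - ((s : ℤ) : ℂ) * d * N) • ((A + B) * y) =
        y * A - qpow (c - ((s : ℤ) : ℂ) * d * N) • (A * y) := by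
      rw [mul_add, add_mul, hy', smul_add]; abel
    rw [h]
    refine ih _ _ ?_
    -- Moving `B` past the extra `A` raises the exponent by `2 s d`. Since `c` grows by `s d` and
    -- `N` drops by one, this is the exponent required by the induction hypothesis.
    have h1 : y * A * B = qpow (c + ((s : ℤ) : ℂ) * d * (2 - N)) • (B * (y * A)) := by
      rw [mul_assoc, hAB, mul_smul_comm, ← mul_assoc y, hy', smul_mul_assoc, smul_smul, ← qpow_add,
        mul_assoc B]
      congr 2; ring
    have h2 : A * y * B = qpow (c + ((s : ℤ) : ℂ) * d * (2 - N)) • (B * (A * y)) := by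
      rw [mul_assoc, hy', mul_smul_comm, ← mul_assoc A, hAB, smul_mul_assoc, smul_smul, ← qpow_add,
        mul_assoc B]
      congr 2; ring
    rw [show c + ((s : ℤ) : ℂ) * d + ((s : ℤ) : ℂ) * d * (1 - N) =
        c + ((s : ℤ) : ℂ) * d * (2 - N) by ring, sub_mul, smul_mul_assoc, h1, h2, mul_sub B,
      smul_sub, mul_smul_comm, smul_comm]

theorem serreSum_add_left (d : ℕ) (e y z : R) (N : ℕ) :
    serreSum d N e (y + z) = serreSum d N e y + serreSum d N e z := by
  simp [serreSum, mul_add, add_mul, Finset.sum_add_distrib]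

/-- The Serre expression of a sum of two pairs of `q`-commuting elements. -/
theorem serreSum_add (d N : ℕ) (s : ℤˣ) {A B y z : R}
    (hAB : A * B = qpow (2 * (((s : ℤ) : ℂ) * d)) • (B * A))
    (hy : y * B = qpow (((s : ℤ) : ℂ) * d * (1 - N)) • (B * y))
    (hz : A * z = qpow (((s : ℤ) : ℂ) * d * (1 - N)) • (z * A)) :
    serreSum d N (A + B) (y + z) = serreSum d N A y + serreSum d N B z := by
  -- Against `y` the summand `B` drops out with sign `s`. Against `z` the summand `A` drops out with
  -- sign `-s`, because exchanging `A` and `B` inverts the commutation factors.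
  rw [serreSum_add_left, ← serreTwist_zero, ← serreTwist_zero, ← serreTwist_zero,
    ← serreTwist_zero, serreTwist_add d s hAB N 0 y (by rw [hy, zero_add]), add_comm A B,
    serreTwist_add d (-s) (A := B) (B := A) _ N 0 z _]
  · rw [hAB, smul_smul, ← qpow_add]
    simp [qpow_zero]
  · rw [hz, smul_smul, ← qpow_add]
    simp [qpow_zero]

theorem serreSum_mul (n N : ℕ) {x y p r : R} (hxp : Commute x p) (hyp : Commute y p)
    (hxr : Commute x r) (hpr : Commute p r) :
    serreSum n N (x * p) (y * r) = serreSum n N x y * (r * p ^ N) := by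
  rw [serreSum, serreSum, Finset.sum_mul]
  refine Finset.sum_congr rfl fun k hk => ?_
  rw [smul_mul_assoc, hxp.mul_pow, hxp.mul_pow]
  have hk : k ≤ N := by simpa [Nat.lt_succ_iff] using hk
  congr 1
  calc x ^ k * p ^ k * (y * r) * (x ^ (N - k) * p ^ (N - k))
      = x ^ k * (p ^ k * y) * (r * x ^ (N - k)) * p ^ (N - k) := by noncomm_ring
    _ = x ^ k * (y * p ^ k) * (x ^ (N - k) * r) * p ^ (N - k) := by
        rw [(hyp.pow_right k).eq, (hxr.pow_left (N - k)).eq]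
    _ = x ^ k * y * (p ^ k * x ^ (N - k)) * (r * p ^ (N - k)) := by noncomm_ring
    _ = x ^ k * y * (x ^ (N - k) * p ^ k) * (r * p ^ (N - k)) := by
        rw [((hxp.pow_left (N - k)).pow_right k).eq]
    _ = x ^ k * y * x ^ (N - k) * (p ^ k * r * p ^ (N - k)) := by noncomm_ring
    _ = x ^ k * y * x ^ (N - k) * (r * p ^ N) := by
        rw [(hpr.pow_left k).eq, mul_assoc r, ← pow_add, Nat.add_sub_cancel' hk]

end Serre

/-! ## The comultiplication formula respects the defining relations -/

section Coproduct

variable {R : Type*} [Ring R] [Algebra ℂ⟦X⟧ R] [IsHComplete R] {ι : Type*}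
  {a : ι → ι → ℤ} {d : ι → ℕ} {f f₁ f₂ : Gen ι → R}

variable (d f) in
/-- The element `q_i^{c h_i}` for a family of elements indexed by the generators. -/
def cartanExp (c : ℂ) (i : ι) : R := hexp (c * d i) (f (Gen.h i))

variable (d f₁ f₂) in
/-- The family given by the comultiplication formula applied to two families. -/
def coproductFamily : Gen ι → R
  | Gen.h i => f₁ (Gen.h i) + f₂ (Gen.h i)
  | Gen.x s i => f₁ (Gen.x s i) * cartanExp d f₂ (1 / 2) i +
      cartanExp d f₁ (-1 / 2) i * f₂ (Gen.x s i)

theorem SatisfiesRel.cartanExp_mul_x (hf : SatisfiesRel a d f) (c : ℂ) (s : ℤˣ) (i j : ι) :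
    cartanExp d f c i * f (Gen.x s j) =
      qpow (c * d i * (((s : ℤ) * a i j : ℤ) : ℂ)) • (f (Gen.x s j) * cartanExp d f c i) := by
  refine hexp_mul_of_bracket ?_ _
  rw [hf.hx, map_intCast, Int.cast_smul_eq_zsmul]

theorem SatisfiesRel.commute_h_cartanExp (hf : SatisfiesRel a d f) (c : ℂ) (i j : ι) :
    Commute (f (Gen.h i)) (cartanExp d f c j) :=
  commute_hexp (hf.hh i j) _

theorem SatisfiesRel.commute_cartanExp (hf : SatisfiesRel a d f) (c c' : ℂ) (i j : ι) :
    Commute (cartanExp d f c i) (cartanExp d f c' j) :=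
  commute_hexp (hf.commute_h_cartanExp c j i).symm _

theorem commute_cartanExp_of_commute {r : R} {i : ι} (h : Commute r (f (Gen.h i))) (c : ℂ) :
    Commute r (cartanExp d f c i) :=
  commute_hexp h _

variable (hf₁ : SatisfiesRel a d f₁) (hf₂ : SatisfiesRel a d f₂)
  (hc : ∀ g g', Commute (f₁ g) (f₂ g'))
  (hsymm : ∀ i j, (d i : ℤ) * a i j = (d j : ℤ) * a j i)

include hc in
theorem commute_x_cartanExp (g : Gen ι) (c : ℂ) (j : ι) :
    Commute (f₁ g) (cartanExp d f₂ c j) :=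
  commute_cartanExp_of_commute (hc _ _) c

include hc in
theorem commute_cartanExp_x (g : Gen ι) (c : ℂ) (j : ι) :
    Commute (cartanExp d f₁ c j) (f₂ g) :=
  (commute_cartanExp_of_commute (hc _ _).symm c).symm

include hc in
theorem commute_cartanExp_cartanExp (c c' : ℂ) (i j : ι) :
    Commute (cartanExp d f₁ c i) (cartanExp d f₂ c' j) :=
  commute_cartanExp_of_commute (commute_cartanExp_x hc _ _ _) c'

include hf₁ hf₂ hc hsymm in
-- The exponential in each summand is moved past the generator in the other. In terms of the
-- invariant form the exponent is `(s + t)/2` times `d_i a_ij = (α_i, α_j)` (suitably normalised):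
-- zero for opposite signs, and the Serre exponent for equal signs.
theorem coproduct_cross (s t : ℤˣ) (i j : ι) :
    (f₁ (Gen.x s i) * cartanExp d f₂ (1 / 2) i) * (cartanExp d f₁ (-1 / 2) j * f₂ (Gen.x t j)) =
      qpow ((((s : ℤ) : ℂ) + ((t : ℤ) : ℂ)) / 2 * (d i * a i j)) •
        ((cartanExp d f₁ (-1 / 2) j * f₂ (Gen.x t j)) *
          (f₁ (Gen.x s i) * cartanExp d f₂ (1 / 2) i)) := by
  set X := f₁ (Gen.x s i)
  set Y := f₂ (Gen.x t j)
  set P := cartanExp d f₂ (1 / 2) i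
  set Q := cartanExp d f₁ (-1 / 2) j
  have hPY : P * Y = _ := hf₂.cartanExp_mul_x (1 / 2) t i j
  have hQX : Q * X = _ := hf₁.cartanExp_mul_x (-1 / 2) s j i
  have hXY : Commute X Y := hc _ _
  have hQP : Commute Q P := commute_cartanExp_cartanExp hc _ _ _ _
  have h1 : X * P * (Q * Y) = qpow (1 / 2 * d i * (((t : ℤ) * a i j : ℤ) : ℂ)) •
      (X * Q * (Y * P)) := by
    rw [← mul_smul_comm, ← hPY]
    calc X * P * (Q * Y) = X * (P * Q) * Y := by noncomm_ring
      _ = X * (Q * P) * Y := by rw [hQP.eq]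
      _ = X * Q * (P * Y) := by noncomm_ring
  have h2 : Q * Y * (X * P) = qpow (-1 / 2 * d j * (((s : ℤ) * a j i : ℤ) : ℂ)) •
      (X * Q * (Y * P)) := by
    rw [← smul_mul_assoc, ← hQX]
    calc Q * Y * (X * P) = Q * (Y * X) * P := by noncomm_ring
      _ = Q * (X * Y) * P := by rw [hXY.eq]
      _ = Q * X * (Y * P) := by noncomm_ring
  rw [h1, h2, smul_smul, ← qpow_add]
  congr 2
  -- The two exponents are `t d_i a_ij / 2` and `-s d_j a_ji / 2`; symmetrizability lets them be
  -- combined.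
  have h3 : (d i : ℂ) * a i j = d j * a j i := by exact_mod_cast hsymm i j
  push_cast
  linear_combination (-(((s : ℤ) : ℂ)) / 2) * h3

include hf₁ hf₂ hc hsymm in
theorem coproduct_commutator (s : ℤˣ) (i j : ι) :
    coproductFamily d f₁ f₂ (Gen.x s i) * coproductFamily d f₁ f₂ (Gen.x (-s) j) -
      coproductFamily d f₁ f₂ (Gen.x (-s) j) * coproductFamily d f₁ f₂ (Gen.x s i) =
    (f₁ (Gen.x s i) * f₁ (Gen.x (-s) j) - f₁ (Gen.x (-s) j) * f₁ (Gen.x s i)) *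
        (cartanExp d f₂ (1 / 2) i * cartanExp d f₂ (1 / 2) j) +
      (cartanExp d f₁ (-1 / 2) i * cartanExp d f₁ (-1 / 2) j) *
        (f₂ (Gen.x s i) * f₂ (Gen.x (-s) j) - f₂ (Gen.x (-s) j) * f₂ (Gen.x s i)) := by
  have h1 := coproduct_cross hf₁ hf₂ hc hsymm s (-s) i j
  have h2 := coproduct_cross hf₁ hf₂ hc hsymm (-s) s j i
  -- For signs `s` and `-s` the exponent vanishes, so the mixed products commute and cancel in the
  -- commutator.
  have h3 : ((((s : ℤ)) : ℂ) + (((-s : ℤˣ) : ℤ) : ℂ)) = 0 := by simp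
  rw [h3, zero_div, zero_mul, qpow_zero, one_smul] at h1
  rw [add_comm, h3, zero_div, zero_mul, qpow_zero, one_smul] at h2
  have hP : Commute (cartanExp d f₂ (1 / 2) i) (cartanExp d f₂ (1 / 2) j) :=
    hf₂.commute_cartanExp _ _ _ _
  have hQ : Commute (cartanExp d f₁ (-1 / 2) i) (cartanExp d f₁ (-1 / 2) j) :=
    hf₁.commute_cartanExp _ _ _ _
  have mulmul : ∀ {u v w z : R}, Commute w v → u * v * (w * z) = u * w * (v * z) := by
    intro u v w z h
    rw [mul_assoc, ← mul_assoc v, ← h.eq, mul_assoc w, ← mul_assoc]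
  have e1 := mulmul (u := f₁ (Gen.x s i)) (z := cartanExp d f₂ (1 / 2) j)
    (commute_x_cartanExp (d := d) hc (Gen.x (-s) j) (1 / 2) i)
  have e2 := mulmul (u := f₁ (Gen.x (-s) j)) (z := cartanExp d f₂ (1 / 2) i)
    (commute_x_cartanExp (d := d) hc (Gen.x s i) (1 / 2) j)
  have e3 := mulmul (u := cartanExp d f₁ (-1 / 2) i) (z := f₂ (Gen.x (-s) j))
    (commute_cartanExp_x (d := d) hc (Gen.x s i) (-1 / 2) j)
  have e4 := mulmul (u := cartanExp d f₁ (-1 / 2) j) (z := f₂ (Gen.x s i))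
    (commute_cartanExp_x (d := d) hc (Gen.x (-s) j) (-1 / 2) i)
  simp only [coproductFamily, mul_add, add_mul]
  rw [e1, e2, e3, e4, h1, h2, hP.eq, hQ.eq, sub_mul, mul_sub]
  abel

include hf₁ hf₂ hc hsymm in
/-- The comultiplication formula preserves the defining relations. -/
theorem SatisfiesRel.coproduct (hdiag : ∀ i, a i i = 2) (hneg : ∀ i j, i ≠ j → a i j ≤ 0) :
    SatisfiesRel a d (coproductFamily d f₁ f₂) where
  hh i j := by
    simp only [coproductFamily]
    have h1 : Commute (f₁ (Gen.h i)) (f₁ (Gen.h j)) := hf₁.hh i j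
    have h2 : Commute (f₂ (Gen.h i)) (f₂ (Gen.h j)) := hf₂.hh i j
    exact ((h1.add_right (hc _ _)).add_left ((hc _ _).symm.add_right h2)).eq
  hx s i j := by
    have h1 : f₁ (Gen.h i) * f₁ (Gen.x s j) = _ := sub_eq_iff_eq_add.1 (hf₁.hx s i j)
    have h2 : f₂ (Gen.h i) * f₂ (Gen.x s j) = _ := sub_eq_iff_eq_add.1 (hf₂.hx s i j)
    have e1 := hf₁.commute_h_cartanExp (-1 / 2) i j
    have e2 := hf₂.commute_h_cartanExp (1 / 2) i j
    have e3 := commute_x_cartanExp (d := d) hc (Gen.h i) (1 / 2) j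
    have e4 := commute_cartanExp_x (d := d) hc (Gen.h i) (-1 / 2) j
    have e5 := hc (Gen.h i) (Gen.x s j)
    have e6 := hc (Gen.x s j) (Gen.h i)
    simp only [coproductFamily, mul_add, add_mul]
    rw [← mul_assoc (f₁ (Gen.h i)), h1, ← mul_assoc (f₁ (Gen.h i)), e1.eq,
      ← mul_assoc (f₂ (Gen.h i)), ← e6.eq, mul_assoc _ (f₂ (Gen.h i)), e2.eq,
      ← mul_assoc (f₂ (Gen.h i)), ← e4.eq, mul_assoc _ (f₂ (Gen.h i)), h2,
      mul_assoc _ _ (f₁ (Gen.h i)), ← e3.eq, mul_assoc _ _ (f₁ (Gen.h i)), ← e5.eq,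
      add_mul, mul_add, smul_add, smul_mul_assoc, mul_smul_comm]
    simp only [mul_assoc]
    abel
  xx i := by
    rw [coproduct_commutator hf₁ hf₂ hc hsymm 1 i i, hf₁.xx, hf₂.xx]
    simp only [coproductFamily, cartanExp]
    rw [bracket_add (hc _ _), ← hexp_add_left, ← hexp_add_left]
    congr 3 <;> ring
  xx_ne i j hij := by
    rw [← sub_eq_zero, coproduct_commutator hf₁ hf₂ hc hsymm 1 i j, hf₁.xx_ne i j hij,
      hf₂.xx_ne i j hij, sub_self, sub_self, zero_mul, mul_zero, add_zero]
  serre s i j hij := by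
    -- With `N = 1 - a_ij`, the exponent `s d_i (1 - N)` demanded by `serreSum_add` is `s d_i a_ij`,
    -- the one supplied by `coproduct_cross`. Nonpositivity of `a_ij` ensures that `toNat` does not
    -- truncate.
    have hN : ((s : ℤ) : ℂ) * d i * (1 - ((1 - a i j).toNat : ℂ)) =
        (((s : ℤ) : ℂ) + ((s : ℤ) : ℂ)) / 2 * (d i * a i j) := by
      have : (((1 - a i j).toNat : ℤ) : ℂ) = ((1 - a i j : ℤ) : ℂ) := by
        rw [Int.toNat_of_nonneg (by have := hneg i j hij; omega)]
      rw [Int.cast_natCast] at this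
      rw [this]
      push_cast
      ring
    simp only [coproductFamily]
    rw [serreSum_add (d i) _ s, serreSum_mul, hf₁.serre s i j hij, zero_mul, zero_add]
    · rw [(commute_cartanExp_x hc _ _ _).eq, (commute_cartanExp_x hc _ _ _).eq, serreSum_mul,
        hf₂.serre s i j hij, zero_mul]
      · exact (commute_cartanExp_x hc _ _ _).symm
      · exact (commute_cartanExp_x hc _ _ _).symm
      · exact (commute_cartanExp_x hc _ _ _).symm
      · exact hf₁.commute_cartanExp _ _ _ _
    · exact commute_x_cartanExp hc _ _ _
    · exact commute_x_cartanExp hc _ _ _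
    · exact commute_x_cartanExp hc _ _ _
    · exact hf₂.commute_cartanExp _ _ _ _
    · rw [coproduct_cross hf₁ hf₂ hc hsymm s s i i, hdiag]
      congr 2; push_cast; ring
    · rw [coproduct_cross hf₁ hf₂ hc hsymm s s j i, hN]
      congr 3
      exact_mod_cast (hsymm i j).symm
    · rw [coproduct_cross hf₁ hf₂ hc hsymm s s i j, hN]

end Coproduct

/-! ## Complete rings -/

instance : IsHComplete ℂ⟦X⟧ where
  exists_filtration := by
    refine ⟨fun n => (Ideal.span {(PowerSeries.X : ℂ⟦X⟧) ^ n}).toAddSubgroup, ?_⟩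
    have hK : ∀ n (p : ℂ⟦X⟧), p ∈ (Ideal.span {(PowerSeries.X : ℂ⟦X⟧) ^ n}).toAddSubgroup ↔
        ∀ m < n, PowerSeries.coeff m p = 0 := fun n p => by
      rw [← PowerSeries.X_pow_dvd_iff, ← Ideal.mem_span_singleton]; rfl
    refine ⟨fun n p => ?_, fun n r => ?_, fun n r s => ?_, fun n r s => ?_, fun r h => ?_,
      fun u h => ⟨PowerSeries.mk fun k => PowerSeries.coeff k (u (k + 1)), fun n => ?_⟩⟩
    · rw [hK, hK]
      exact fun h m hm => h m (by omega)
    · exact Ideal.mem_span_singleton.2 (Dvd.intro _ rfl)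
    · exact Ideal.mul_mem_left _ _
    · exact Ideal.mul_mem_right _ _
    · ext n
      exact (hK _ _).1 (h (n + 1)) n n.lt_succ_self
    · rw [hK]
      intro m hm
      rw [map_sub, PowerSeries.coeff_mk, sub_eq_zero]
      induction n, hm using Nat.le_induction with
      | base => rfl
      | succ n hn ih =>
        rw [ih, eq_comm, ← sub_eq_zero, ← map_sub]
        exact (hK _ _).1 (h n) m hn

instance {R : Type*} [Ring R] [Algebra ℂ⟦X⟧ R] [IsHComplete R] : IsHComplete Rᵐᵒᵖ where
  exists_filtration := by
    obtain ⟨K, hK⟩ := IsHComplete.exists_filtration (R := R)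
    refine ⟨fun n => (K n).comap (MulOpposite.opAddEquiv (α := R)).symm.toAddMonoidHom,
      fun n p hp => hK.anti n hp, fun n r => hK.pow_smul_mem n r.unop,
      fun n r s hs => hK.mul_mem_right n s.unop r.unop hs,
      fun n r s hr => hK.mul_mem_left n s.unop r.unop hr,
      fun r hr => MulOpposite.unop_injective (hK.eq_zero r.unop hr), fun u hu => ?_⟩
    obtain ⟨L, hL⟩ := hK.complete (fun n => (u n).unop) hu
    exact ⟨MulOpposite.op L, hL⟩

open Topology in
-- A sequence with increments in `K n` is Cauchy because the `K n` shrink to zero, and closedness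
-- keeps the error of the limit inside `K n`.
theorem isHComplete_of_isClosed {R : Type*} [Ring R] [Algebra ℂ⟦X⟧ R] [UniformSpace R]
    [IsUniformAddGroup R] [CompleteSpace R] [T0Space R] (K : ℕ → AddSubgroup R)
    (anti : Antitone K) (closed : ∀ n, IsClosed (K n : Set R))
    (small : ∀ U ∈ 𝓝 (0 : R), ∃ n, (K n : Set R) ⊆ U)
    (pow_smul_mem : ∀ n (r : R), (PowerSeries.X : ℂ⟦X⟧) ^ n • r ∈ K n)
    (mul_mem_left : ∀ n (r s : R), s ∈ K n → r * s ∈ K n)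
    (mul_mem_right : ∀ n (r s : R), r ∈ K n → r * s ∈ K n) : IsHComplete R := by
  refine ⟨K, fun n => anti n.le_succ, pow_smul_mem, mul_mem_left, mul_mem_right, fun r hr => ?_,
    fun u hu => ?_⟩
  · by_contra h0
    obtain ⟨n, hn⟩ := small {r}ᶜ (isOpen_compl_singleton.mem_nhds (Ne.symm h0))
    exact hn (hr n) rfl
  · have h1 : ∀ n m, n ≤ m → u m - u n ∈ K n := by
      intro n m hm
      induction m, hm using Nat.le_induction with
      | base => simp
      | succ m hm ih => simpa using (K n).add_mem (anti hm (hu m)) ih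
    have h2 : CauchySeq u := by
      refine cauchySeq_iff.2 fun V hV => ?_
      rw [uniformity_eq_comap_nhds_zero] at hV
      obtain ⟨U, hU, hUV⟩ := hV
      obtain ⟨n, hn⟩ := small U hU
      refine ⟨n, fun k hk l hl => hUV (hn ?_)⟩
      simpa using (K n).sub_mem (h1 n l hl) (h1 n k hk)
    obtain ⟨L, hL⟩ := cauchySeq_tendsto_of_complete h2
    refine ⟨L, fun n => (closed n).mem_of_tendsto (hL.sub_const (u n)) ?_⟩
    filter_upwards [Filter.eventually_ge_atTop n] with m hm using h1 n m hm

theorem hPow_antitone (B : Type*) [Ring B] [Algebra ℂ⟦X⟧ B] : Antitone (hPow B) := by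
  refine antitone_nat_of_succ_le fun n y hy => ?_
  obtain ⟨b, rfl⟩ := mem_hPow.1 hy
  exact mem_hPow.2 ⟨(PowerSeries.X : ℂ⟦X⟧) • b, by rw [smul_smul, pow_succ]⟩

namespace Uh

variable {ι : Type*} {a : ι → ι → ℤ} {d : ι → ℕ}

instance : IsHComplete (Uh a d) := by
  refine isHComplete_of_isClosed (hPow (Uh a d)) (hPow_antitone _) (fun n => ?_) (fun U hU => ?_)
    (fun n r => mem_hPow.2 ⟨r, rfl⟩) (fun n r s hs => ?_) (fun n r s hr => ?_)
  · exact AddSubgroup.isClosed_of_isOpen _ ((hPow (Uh a d) n).isOpen_of_mem_nhds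
      ((basis0 a d).mem_of_mem trivial))
  · obtain ⟨n, -, hn⟩ := (basis0 a d).mem_iff.1 hU
    exact ⟨n, hn⟩
  · obtain ⟨b, rfl⟩ := mem_hPow.1 hs
    exact mem_hPow.2 ⟨r * b, by simp⟩
  · obtain ⟨b, rfl⟩ := mem_hPow.1 hr
    exact mem_hPow.2 ⟨b * s, by simp⟩

theorem tensor_basis0 : (nhds (0 : Tensor a d)).HasBasis (fun _ => True)
    fun n => (hPow (Tensor a d) n : Set _) :=
  (hPow_basis (Tensor a d)).hasBasis_nhds_zero

variable (a d) in
/-- The closure of `hⁿ (U_h ⊗ U_h)` in the completed tensor product. -/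
def cPow (n : ℕ) : AddSubgroup (CTensor a d) :=
  ((hPow (Tensor a d) n).map
    (UniformSpace.Completion.toCompl : Tensor a d →+ CTensor a d)).topologicalClosure

theorem coe_mem_cPow {n : ℕ} {t : Tensor a d} (ht : t ∈ hPow (Tensor a d) n) :
    (t : CTensor a d) ∈ cPow a d n :=
  AddSubgroup.le_topologicalClosure _ ⟨t, ht, rfl⟩

theorem isClosed_cPow (n : ℕ) : IsClosed (cPow a d n : Set (CTensor a d)) :=
  AddSubgroup.isClosed_topologicalClosure _

theorem cPow_le_of_isClosed {n : ℕ} {s : Set (CTensor a d)} (hs : IsClosed s)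
    (h : ∀ t ∈ hPow (Tensor a d) n, (t : CTensor a d) ∈ s) : (cPow a d n : Set _) ⊆ s :=
  closure_minimal (by rintro _ ⟨t, ht, rfl⟩; exact h t ht) hs

/-- The closures `cPow` serve as the filtration, so it need not be known that `hⁿ` times the
completion is closed or that `U_h ⊗ U_h` is itself separated. The ideal properties pass from the
tensor product by density and continuity. -/
instance : IsHComplete (CTensor a d) := by
  refine isHComplete_of_isClosed (cPow a d) (fun m n hmn => ?_) isClosed_cPow (fun U hU => ?_)
    (fun n r => ?_) (fun n r s hs => ?_) (fun n r s hr => ?_)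
  · exact cPow_le_of_isClosed (isClosed_cPow m) fun t ht => coe_mem_cPow (hPow_antitone _ hmn ht)
  · obtain ⟨V, ⟨hV, hVc⟩, hVU⟩ := (closed_nhds_basis (0 : CTensor a d)).mem_iff.1 hU
    have h1 : (fun t : Tensor a d => (t : CTensor a d)) ⁻¹' V ∈ nhds (0 : Tensor a d) :=
      (UniformSpace.Completion.continuous_coe _).continuousAt.preimage_mem_nhds
        (by rw [UniformSpace.Completion.coe_zero]; exact hV)
    obtain ⟨n, -, hn⟩ := tensor_basis0.mem_iff.1 h1
    exact ⟨n, (cPow_le_of_isClosed hVc fun t ht => hn ht).trans hVU⟩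
  · induction r using UniformSpace.Completion.induction_on with
    | hp => exact (isClosed_cPow n).preimage (continuous_const_smul _)
    | ih t =>
      rw [← UniformSpace.Completion.coe_smul]
      exact coe_mem_cPow (mem_hPow.2 ⟨t, rfl⟩)
  · refine cPow_le_of_isClosed ((isClosed_cPow n).preimage (continuous_const_mul r))
      (fun t ht => ?_) hs
    change r * (t : CTensor a d) ∈ cPow a d n
    induction r using UniformSpace.Completion.induction_on with
    | hp => exact (isClosed_cPow n).preimage (continuous_mul_const _)
    | ih v =>
      obtain ⟨b, rfl⟩ := mem_hPow.1 ht
      rw [← UniformSpace.Completion.coe_mul]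
      exact coe_mem_cPow (mem_hPow.2 ⟨v * b, by simp⟩)
  · refine cPow_le_of_isClosed ((isClosed_cPow n).preimage (continuous_mul_const s))
      (fun t ht => ?_) hr
    change (t : CTensor a d) * s ∈ cPow a d n
    induction s using UniformSpace.Completion.induction_on with
    | hp => exact (isClosed_cPow n).preimage (continuous_const_mul _)
    | ih v =>
      obtain ⟨b, rfl⟩ := mem_hPow.1 ht
      rw [← UniformSpace.Completion.coe_mul]
      exact coe_mem_cPow (mem_hPow.2 ⟨b * v, by simp⟩)

end Uh

/-! ## Semilinear homomorphisms and antihomomorphisms -/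

/-- A unital `σ`-linear ring homomorphism. -/
structure IsSemiHom {A B : Type*} [Ring A] [Algebra ℂ⟦X⟧ A] [Ring B] [Algebra ℂ⟦X⟧ B]
    (σ : ℂ⟦X⟧ →+* ℂ⟦X⟧) (φ : A → B) : Prop where
  map_add (y z : A) : φ (y + z) = φ y + φ z
  map_smul (c : ℂ⟦X⟧) (y : A) : φ (c • y) = σ c • φ y
  map_one : φ 1 = 1
  map_mul (y z : A) : φ (y * z) = φ y * φ z

/-- A unital `σ`-linear ring antihomomorphism. -/
structure IsSemiAntiHom {A B : Type*} [Ring A] [Algebra ℂ⟦X⟧ A] [Ring B] [Algebra ℂ⟦X⟧ B]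
    (σ : ℂ⟦X⟧ →+* ℂ⟦X⟧) (φ : A → B) : Prop where
  map_add (y z : A) : φ (y + z) = φ y + φ z
  map_smul (c : ℂ⟦X⟧) (y : A) : φ (c • y) = σ c • φ y
  map_one : φ 1 = 1
  map_mul (y z : A) : φ (y * z) = φ z * φ y

section SemiHom

variable {A B C : Type*} [Ring A] [Algebra ℂ⟦X⟧ A] [Ring B] [Algebra ℂ⟦X⟧ B]
  [Ring C] [Algebra ℂ⟦X⟧ C] {σ τ υ : ℂ⟦X⟧ →+* ℂ⟦X⟧} {φ : A → B} {ψ : B → C}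

theorem AlgHom.isSemiHom (f : A →ₐ[ℂ⟦X⟧] B) : IsSemiHom (RingHom.id _) f :=
  ⟨map_add f, map_smul f, map_one f, map_mul f⟩

theorem isSemiHom_id : IsSemiHom (RingHom.id _) (fun y : A => y) :=
  ⟨fun _ _ => rfl, fun _ _ => rfl, rfl, fun _ _ => rfl⟩

theorem IsSemiHom.comp (hψ : IsSemiHom τ ψ) (hφ : IsSemiHom σ φ) (h : ∀ c, τ (σ c) = υ c) :
    IsSemiHom υ (fun y => ψ (φ y)) :=
  ⟨fun y z => by rw [hφ.map_add, hψ.map_add], fun c y => by rw [hφ.map_smul, hψ.map_smul, h],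
    by rw [hφ.map_one, hψ.map_one], fun y z => by rw [hφ.map_mul, hψ.map_mul]⟩

theorem IsSemiAntiHom.comp (hψ : IsSemiAntiHom τ ψ) (hφ : IsSemiAntiHom σ φ)
    (h : ∀ c, τ (σ c) = υ c) : IsSemiHom υ (fun y => ψ (φ y)) :=
  ⟨fun y z => by rw [hφ.map_add, hψ.map_add], fun c y => by rw [hφ.map_smul, hψ.map_smul, h],
    by rw [hφ.map_one, hψ.map_one], fun y z => by rw [hφ.map_mul, hψ.map_mul]⟩

theorem IsSemiHom.comp_anti (hψ : IsSemiHom τ ψ) (hφ : IsSemiAntiHom σ φ)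
    (h : ∀ c, τ (σ c) = υ c) : IsSemiAntiHom υ (fun y => ψ (φ y)) :=
  ⟨fun y z => by rw [hφ.map_add, hψ.map_add], fun c y => by rw [hφ.map_smul, hψ.map_smul, h],
    by rw [hφ.map_one, hψ.map_one], fun y z => by rw [hφ.map_mul, hψ.map_mul]⟩

theorem IsSemiAntiHom.comp_hom (hψ : IsSemiAntiHom τ ψ) (hφ : IsSemiHom σ φ)
    (h : ∀ c, τ (σ c) = υ c) : IsSemiAntiHom υ (fun y => ψ (φ y)) :=
  ⟨fun y z => by rw [hφ.map_add, hψ.map_add], fun c y => by rw [hφ.map_smul, hψ.map_smul, h],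
    by rw [hφ.map_one, hψ.map_one], fun y z => by rw [hφ.map_mul, hψ.map_mul]⟩

theorem IsSemiHom.map_zero (hφ : IsSemiHom σ φ) : φ 0 = 0 := by
  simpa using hφ.map_smul 0 0

/-- A semilinear homomorphism as a ring homomorphism. -/
def IsSemiHom.toRingHom (hφ : IsSemiHom σ φ) : A →+* B where
  toFun := φ
  map_zero' := hφ.map_zero
  map_add' := hφ.map_add
  map_one' := hφ.map_one
  map_mul' := hφ.map_mul

theorem IsSemiAntiHom.op (hφ : IsSemiAntiHom σ φ) :
    IsSemiHom σ (fun y => MulOpposite.op (φ y)) :=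
  ⟨fun y z => by rw [hφ.map_add]; rfl, fun c y => by rw [hφ.map_smul]; rfl,
    by rw [hφ.map_one]; rfl, fun y z => by rw [hφ.map_mul]; rfl⟩

theorem IsSemiHom.unop {φ : A → Bᵐᵒᵖ} (hφ : IsSemiHom σ φ) :
    IsSemiAntiHom σ (fun y => (φ y).unop) :=
  ⟨fun y z => by rw [hφ.map_add]; rfl, fun c y => by rw [hφ.map_smul]; rfl,
    by rw [hφ.map_one]; rfl, fun y z => by rw [hφ.map_mul]; rfl⟩

end SemiHom

/-! ## `q`-conjugation of scalars -/

theorem qconj_X : qconj PowerSeries.X = PowerSeries.X * -1 := by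
  ext n
  rw [qconj, PowerSeries.coeff_rescale, mul_neg, mul_one, map_neg, PowerSeries.coeff_X]
  split_ifs with h <;> simp [h]

theorem qconj_qconj (c : ℂ⟦X⟧) : qconj (qconj c) = c := by
  ext n
  rw [qconj, PowerSeries.coeff_rescale, PowerSeries.coeff_rescale, ← mul_assoc, ← mul_pow]
  simp

theorem qconj_qpow (c : ℂ) : qconj (qpow c) = qpow (-c) := by
  ext n
  rw [qconj, qpow, qpow, PowerSeries.coeff_rescale, PowerSeries.coeff_rescale,
    PowerSeries.coeff_rescale, ← mul_assoc, ← mul_pow, neg_one_mul]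

theorem qconj_divX (c : ℂ⟦X⟧) : qconj (divX c) = -divX (qconj c) := by
  ext n
  simp [qconj, divX, PowerSeries.coeff_rescale, pow_succ]

theorem qconj_inv (c : ℂ⟦X⟧) : qconj c⁻¹ = (qconj c)⁻¹ := by
  have h0 : PowerSeries.constantCoeff (qconj c) = PowerSeries.constantCoeff c := by
    rw [← PowerSeries.coeff_zero_eq_constantCoeff_apply, qconj, PowerSeries.coeff_rescale]
    simp
  -- A series without constant term has inverse `0` by convention, and conjugation preserves the
  -- constant term.
  by_cases h : PowerSeries.constantCoeff c = 0
  · rw [PowerSeries.inv_eq_zero.2 h, PowerSeries.inv_eq_zero.2 (h0.trans h), map_zero]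
  · rw [PowerSeries.eq_inv_iff_mul_eq_one (by rwa [h0]), ← map_mul,
      PowerSeries.inv_mul_cancel _ h, map_one]

/-- The reflection `j ↦ n - 1 - j` negates the exponents, which undoes `q ↦ q⁻¹`. -/
theorem qconj_qInt (d n : ℕ) : qconj (qInt d n) = qInt d n := by
  rw [qInt, map_sum, ← Finset.sum_range_reflect]
  refine Finset.sum_congr rfl fun j hj => ?_
  rw [qconj_qpow]
  congr 1
  rw [Nat.sub_sub, Nat.cast_sub (by have := Finset.mem_range.1 hj; omega)]
  push_cast
  ring

theorem qconj_qBinom (d n k : ℕ) : qconj (qBinom d n k) = qBinom d n k := by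
  have h : ∀ m, qconj (qFactorial d m) = qFactorial d m := fun m => by
    rw [qFactorial, map_prod]; exact Finset.prod_congr rfl fun j _ => qconj_qInt d _
  rw [qBinom, map_mul, qconj_inv, map_mul, h, h, h]

/-! ## `q`-conjugation of the completed free algebra -/

/-- The substitution `h ↦ -h`. -/
def negVar (A : Type*) [Ring A] : A⟦X⟧ →+* A⟦X⟧ where
  toFun p := PowerSeries.mk fun n => ((-1 : ℤ) ^ n) • PowerSeries.coeff n p
  map_zero' := by ext n; simp
  map_one' := by ext n; cases n <;> simp [PowerSeries.coeff_one]
  map_add' p q := by ext n; simp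
  map_mul' p q := by
    ext n
    simp only [PowerSeries.coeff_mk, PowerSeries.coeff_mul, Finset.smul_sum]
    refine Finset.sum_congr rfl fun k hk => ?_
    rw [smul_mul_smul_comm, ← pow_add, Finset.HasAntidiagonal.mem_antidiagonal.1 hk]

theorem coeff_negVar {A : Type*} [Ring A] (p : A⟦X⟧) (n : ℕ) :
    PowerSeries.coeff n (negVar A p) = ((-1 : ℤ) ^ n) • PowerSeries.coeff n p := by
  rw [negVar, RingHom.coe_mk, MonoidHom.coe_mk, OneHom.coe_mk, PowerSeries.coeff_mk]

section NegVar

variable {ι : Type*}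

theorem negVar_smul (c : ℂ⟦X⟧) (p : FreeSeries ι) :
    negVar _ (c • p) = qconj c • negVar _ p := by
  rw [FreeSeries.smul_eq, map_mul, FreeSeries.smul_eq]
  congr 1
  ext n
  rw [coeff_negVar, PowerSeries.coeff_map, PowerSeries.coeff_map, qconj, PowerSeries.coeff_rescale]
  simp

theorem negVar_C {A : Type*} [Ring A] (r : A) :
    negVar A (PowerSeries.C r) = PowerSeries.C r := by
  ext n
  rw [coeff_negVar, PowerSeries.coeff_C]
  split_ifs with h <;> simp [h]

theorem negVar_X {A : Type*} [Ring A] : negVar A PowerSeries.X = -PowerSeries.X := by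
  ext n
  rw [coeff_negVar, map_neg, PowerSeries.coeff_X]
  split_ifs with h <;> simp [h]

theorem negVar_divX {A : Type*} [Ring A] (p : A⟦X⟧) :
    negVar A (divX p) = -divX (negVar A p) := by
  ext n
  simp [coeff_negVar, divX, pow_succ]

theorem negVar_qpowH (c : ℂ) (i : ι) :
    negVar _ (FreeSeries.qpowH c i) = FreeSeries.qpowH (-c) i := by
  ext n
  rw [coeff_negVar, FreeSeries.qpowH, FreeSeries.qpowH, PowerSeries.coeff_mk,
    PowerSeries.coeff_mk, ← Int.cast_smul_eq_zsmul ℂ, smul_smul, neg_pow c]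
  push_cast
  rw [mul_div_assoc]

theorem negVar_gh (i : ι) : negVar _ (FreeSeries.gh i) = FreeSeries.gh i := negVar_C _

theorem negVar_gx (s : ℤˣ) (i : ι) : negVar _ (FreeSeries.gx s i) = FreeSeries.gx s i := negVar_C _

/-- Numerator and denominator are odd under `h ↦ -h`. Division by `h` makes both even, so the
quotient is fixed. -/
theorem negVar_bracketH (d : ℕ) (i : ι) :
    negVar _ (FreeSeries.bracketH d i) = FreeSeries.bracketH d i := by
  rw [FreeSeries.bracketH, negVar_smul, qconj_inv, qconj_divX, map_sub, qconj_qpow, qconj_qpow,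
    negVar_divX, map_sub, negVar_qpowH, negVar_qpowH, neg_neg, ← divX_neg, ← divX_neg,
    neg_sub, neg_sub]

theorem negVar_rel {a : ι → ι → ℤ} {d : ι → ℕ} {r : FreeSeries ι} (hr : FreeSeries.Rel a d r) :
    negVar _ r = r := by
  cases hr with
  | hh i j => simp only [map_sub, map_mul, negVar_gh]
  | hx s i j => simp only [map_sub, map_mul, map_zsmul, negVar_gh, negVar_gx]
  | xx i => simp only [map_sub, map_mul, negVar_gx, negVar_bracketH]
  | xx_ne i j hij => simp only [map_sub, map_mul, negVar_gx]
  | serre s i j hij =>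
    simp only [FreeSeries.serre, map_sum, negVar_smul, map_mul, map_pow, negVar_gx, map_neg,
      map_one, qconj_qBinom]

end NegVar

namespace Uh

variable {ι : Type*} {a : ι → ι → ℤ} {d : ι → ℕ}

theorem isSemiHom_ext {R : Type*} [Ring R] [Algebra ℂ⟦X⟧ R] [IsHComplete R]
    {σ : ℂ⟦X⟧ →+* ℂ⟦X⟧} {c : ℂ⟦X⟧} (hσ : σ PowerSeries.X = PowerSeries.X * c) {φ ψ : Uh a d → R}
    (hφ : IsSemiHom σ φ) (hψ : IsSemiHom σ ψ)
    (hh : ∀ i, φ (h a d i) = ψ (h a d i)) (hx : ∀ s i, φ (x a d s i) = ψ (x a d s i))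
    (y : Uh a d) : φ y = ψ y := by
  have := ringHom_ext (φ := hφ.toRingHom) (ψ := hψ.toRingHom) hσ hφ.map_smul hψ.map_smul hh hx
  exact congrArg (fun f : Uh a d →+* R => f y) this

theorem isSemiAntiHom_ext {R : Type*} [Ring R] [Algebra ℂ⟦X⟧ R] [IsHComplete R]
    {σ : ℂ⟦X⟧ →+* ℂ⟦X⟧} {c : ℂ⟦X⟧} (hσ : σ PowerSeries.X = PowerSeries.X * c) {φ ψ : Uh a d → R}
    (hφ : IsSemiAntiHom σ φ) (hψ : IsSemiAntiHom σ ψ)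
    (hh : ∀ i, φ (h a d i) = ψ (h a d i)) (hx : ∀ s i, φ (x a d s i) = ψ (x a d s i))
    (y : Uh a d) : φ y = ψ y :=
  MulOpposite.op_injective (isSemiHom_ext hσ hφ.op hψ.op
    (fun i => congrArg MulOpposite.op (hh i)) (fun s i => congrArg MulOpposite.op (hx s i)) y)

/-! ## `q`-conjugation of `U_h` -/

/-- The substitution sends the variable to `-h`, which is the case `c = -1` of
`map_relIdeal_eq_zero`. -/
theorem mk_negVar_eq_zero (p : FreeSeries ι) (hp : p ∈ FreeSeries.relIdeal a d) :
    ((mk a d : FreeSeries ι →+* Uh a d).comp (negVar _)) p = 0 := by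
  refine map_relIdeal_eq_zero (c := -1) _ ?_ (fun r hr => ?_) hp
  · have := mk_X_mul (a := a) (d := d) 1
    rw [mul_one, map_one] at this
    simp only [RingHom.comp_apply, negVar_X, map_neg, RingHom.coe_coe, this,
      mul_neg, mul_one, Algebra.algebraMap_eq_smul_one]
  · rw [RingHom.comp_apply, negVar_rel hr]
    exact mk_eq_zero ((TwoSidedIdeal.mem_iInf _).2 fun n => TwoSidedIdeal.subset_span (Or.inl hr))

variable (a d) in
/-- `q`-conjugation on `U_h`. -/
def conj : Uh a d →ₛₗ[qconj] Uh a d where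
  toFun := descend _ mk_negVar_eq_zero
  map_add' := map_add _
  map_smul' := by
    intro c y
    obtain ⟨p, rfl⟩ := mk_surj a d y
    rw [← map_smul, descend_mk, descend_mk]
    simp only [RingHom.comp_apply, negVar_smul, RingHom.coe_coe, map_smul]

theorem conj_mk (p : FreeSeries ι) : conj a d (mk a d p) = mk a d (negVar _ p) :=
  descend_mk _ mk_negVar_eq_zero p

theorem isQConj_conj : IsQConj (conj a d) where
  map_one := map_one (descend _ mk_negVar_eq_zero)
  map_mul := map_mul (descend _ mk_negVar_eq_zero)
  map_h i := by rw [h, conj_mk, negVar_gh]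
  map_x s i := by rw [x, conj_mk, negVar_gx]

theorem IsQConj.isSemiHom {κ : Uh a d →ₛₗ[qconj] Uh a d} (hκ : IsQConj κ) : IsSemiHom qconj κ :=
  ⟨κ.map_add, κ.map_smulₛₗ, hκ.map_one, hκ.map_mul⟩

theorem existsUnique_isQConj : ∃! κ : Uh a d →ₛₗ[qconj] Uh a d, IsQConj κ :=
  ⟨conj a d, isQConj_conj, fun _ hκ => LinearMap.ext fun y =>
    isSemiHom_ext qconj_X hκ.isSemiHom isQConj_conj.isSemiHom
      (fun i => (hκ.map_h i).trans (isQConj_conj.map_h i).symm)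
      (fun s i => (hκ.map_x s i).trans (isQConj_conj.map_x s i).symm) y⟩

end Uh

/-! ## Opposite rings -/

section Opposite

variable {R : Type*} [Ring R] [Algebra ℂ⟦X⟧ R]

/-- Reversing products exchanges `k` and `N - k`. The binomials are symmetric under this, so only
the sign `(-1)^N` remains. -/
theorem serreSum_op (d N : ℕ) (e y : R) :
    serreSum d N (MulOpposite.op e) (MulOpposite.op y) =
      MulOpposite.op ((-1 : ℂ⟦X⟧) ^ N • serreSum d N e y) := by
  rw [serreSum, serreSum, ← Finset.sum_flip, Finset.smul_sum, Finset.op_sum]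
  refine Finset.sum_congr rfl fun k hk => ?_
  have hk : k ≤ N := by simpa [Nat.lt_succ_iff] using hk
  rw [qBinom_symm d hk, Nat.sub_sub_self hk, smul_smul, ← mul_assoc, ← pow_add]
  have h : (-1 : ℂ⟦X⟧) ^ (N + k) = (-1) ^ (N - k) := by
    rw [show N + k = (N - k) + 2 * k by omega, pow_add, pow_mul]
    simp
  rw [h, ← MulOpposite.op_pow, ← MulOpposite.op_pow, ← MulOpposite.op_mul, ← MulOpposite.op_mul,
    mul_assoc, MulOpposite.op_smul]

theorem serreSum_smul (d N : ℕ) (c c' : ℂ⟦X⟧) (e y : R) :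
    serreSum d N (c • e) (c' • y) = (c ^ N * c') • serreSum d N e y := by
  rw [serreSum, serreSum, Finset.smul_sum]
  refine Finset.sum_congr rfl fun k hk => ?_
  have hk : k ≤ N := by simpa [Nat.lt_succ_iff] using hk
  simp only [smul_pow, smul_mul_assoc, mul_smul_comm, smul_smul]
  congr 1
  rw [← Nat.add_sub_cancel' hk, pow_add, Nat.add_sub_cancel_left]
  ring

variable [IsHComplete R]

theorem hEval_op (p : R⟦X⟧) :
    hEval Rᵐᵒᵖ (PowerSeries.mk fun n => MulOpposite.op (PowerSeries.coeff n p)) =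
      MulOpposite.op (hEval R p) := by
  have := eq_of_shift (φ := id) (f := fun p : R⟦X⟧ =>
    (hEval Rᵐᵒᵖ (PowerSeries.mk fun n => MulOpposite.op (PowerSeries.coeff n p))).unop)
    (g := hEval R) (fun p => ?_) hEval_eq
  · exact MulOpposite.unop_injective (congrFun this p)
  · rw [hEval_eq, PowerSeries.coeff_mk, MulOpposite.unop_add, MulOpposite.unop_smul]
    congr 4
    ext n
    simp [divX]

theorem bracket_op (d : ℕ) (r : R) :
    bracket d (MulOpposite.op r) = MulOpposite.op (bracket d r) := by
  rw [bracket, bracket, MulOpposite.op_smul, ← hEval_op]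
  congr 2
  ext n
  simp [divX, expSeries]

end Opposite

namespace Uh

variable {ι : Type*} {a : ι → ι → ℤ} {d : ι → ℕ}

variable (a d) in
/-- The generators of `U_h`. -/
def gens : Gen ι → Uh a d
  | Gen.h i => h a d i
  | Gen.x s i => x a d s i

/-- Writing the quotient map as an evaluation turns the defining relations, stated with `qpowH` and
`bracketH`, into relations between `hexp` and `bracket` inside `U_h`. -/
theorem mk_eq_seriesHom (p : FreeSeries ι) : mk a d p = seriesHom (gens a d) p := by
  have h0 : (mk a d : FreeSeries ι →+* Uh a d).comp PowerSeries.C = freeHom (gens a d) := by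
    ext z
    induction z using FreeAlgebra.induction with
    | grade0 c =>
      rw [freeHom_algebraMap]
      exact (mk_C_algebraMap c).trans (Algebra.algebraMap_eq_smul_one _).symm
    | grade1 g =>
      rw [freeHom_ι]
      cases g <;> rfl
    | mul z w hz hw => rw [map_mul, map_mul, hz, hw]
    | add z w hz hw => rw [map_add, map_add, hz, hw]
  rw [seriesHom_apply, ← h0, ← map_eq_hEval]
  · rfl
  · exact mk_X_mul

theorem mk_rel {r : FreeSeries ι} (hr : FreeSeries.Rel a d r) : seriesHom (gens a d) r = 0 := by
  rw [← mk_eq_seriesHom]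
  exact mk_eq_zero ((TwoSidedIdeal.mem_iInf _).2 fun n => TwoSidedIdeal.subset_span (Or.inl hr))

theorem satisfiesRel_gens : SatisfiesRel a d (gens a d) where
  hh i j := by simpa [sub_eq_zero] using mk_rel (a := a) (d := d) (.hh i j)
  hx s i j := by
    have := mk_rel (a := a) (d := d) (.hx s i j)
    rw [map_sub, map_sub, map_mul, map_mul, map_zsmul, sub_eq_zero] at this
    simpa using this
  xx i := by
    have := mk_rel (a := a) (d := d) (.xx i)
    rw [map_sub, map_sub, map_mul, map_mul, sub_eq_zero] at this
    simpa using this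
  xx_ne i j hij := by simpa [sub_eq_zero] using mk_rel (a := a) (d := d) (.xx_ne i j hij)
  serre s i j hij := by
    have := mk_rel (a := a) (d := d) (.serre s i j hij)
    rwa [seriesHom_serre] at this

theorem qh_eq (c : ℂ) (i : ι) : qh a d c i = cartanExp d (gens a d) c i := by
  rw [qh, mk_eq_seriesHom, seriesHom_qpowH, cartanExp]

section

variable {R R' : Type*} [Ring R] [Algebra ℂ⟦X⟧ R] [IsHComplete R] [Ring R'] [Algebra ℂ⟦X⟧ R']
  [IsHComplete R']

theorem _root_.QuantumGroup.SatisfiesRel.map {f : Gen ι → R} (hf : SatisfiesRel a d f)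
    (φ : R →ₐ[ℂ⟦X⟧] R') : SatisfiesRel a d (fun g => φ (f g)) where
  hh i j := by rw [← map_mul, hf.hh, map_mul]
  hx s i j := by rw [← map_mul, ← map_mul, ← map_sub, hf.hx, map_zsmul]
  xx i := by rw [← map_mul, ← map_mul, ← map_sub, hf.xx, map_bracket]
  xx_ne i j hij := by rw [← map_mul, hf.xx_ne i j hij, map_mul]
  serre s i j hij := by rw [← map_serreSum, hf.serre s i j hij, map_zero]

end

/-! ## The counit -/

theorem bracket_zero {R : Type*} [Ring R] [Algebra ℂ⟦X⟧ R] [IsHComplete R] (n : ℕ) :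
    bracket n (0 : R) = 0 := by
  have h : expSeries (n : ℂ) (0 : R) = expSeries (-(n : ℂ)) 0 := by
    rw [← expSeries_neg, neg_zero]
  have h0 : divX (0 : R⟦X⟧) = 0 := by ext n; simp [divX]
  rw [bracket, h, sub_self, h0, map_zero, smul_zero]

theorem satisfiesRel_zero : SatisfiesRel a d (fun _ => (0 : ℂ⟦X⟧)) where
  hh i j := rfl
  hx s i j := by simp
  xx i := by simp [bracket_zero]
  xx_ne i j hij := rfl
  serre s i j hij := by simp [serreSum]

theorem existsUnique_isCounit : ∃! ε : Uh a d →ₐ[ℂ⟦X⟧] ℂ⟦X⟧, IsCounit ε :=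
  ⟨lift _ satisfiesRel_zero, ⟨fun _ => lift_h _ _ _, fun _ _ => lift_x _ _ _ _⟩, fun ε hε =>
    algHom_ext (fun i => by rw [hε.map_h, lift_h]) (fun s i => by rw [hε.map_x, lift_x])⟩

/-! ## The Cartan involution -/

variable (a d) in
/-- The images of the generators under the Cartan involution. -/
def cartanFamily : Gen ι → Uh a d
  | Gen.h i => -h a d i
  | Gen.x s i => x a d (-s) i

theorem satisfiesRel_cartanFamily : SatisfiesRel a d (cartanFamily a d) where
  hh i j := by
    have : h a d i * h a d j = h a d j * h a d i := satisfiesRel_gens.hh i j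
    simpa only [cartanFamily, neg_mul_neg]
  hx s i j := by
    have : h a d i * x a d (-s) j - x a d (-s) j * h a d i = _ := satisfiesRel_gens.hx (-s) i j
    simp only [cartanFamily]
    rw [neg_mul, mul_neg, ← neg_sub', this]
    simp [gens]
  xx i := by
    have : x a d 1 i * x a d (-1) i - x a d (-1) i * x a d 1 i = bracket (d i) (h a d i) :=
      satisfiesRel_gens.xx i
    simp only [cartanFamily, neg_neg]
    rw [bracket_neg, ← this, neg_sub]
  xx_ne i j hij := by
    have : x a d 1 j * x a d (-1) i = x a d (-1) i * x a d 1 j :=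
      satisfiesRel_gens.xx_ne j i hij.symm
    simp only [cartanFamily, neg_neg]
    exact this.symm
  serre s i j hij := satisfiesRel_gens.serre (-s) i j hij

theorem existsUnique_isCartanInvolution :
    ∃! θ : Uh a d →ₐ[ℂ⟦X⟧] Uh a d, IsCartanInvolution θ :=
  ⟨lift _ satisfiesRel_cartanFamily, ⟨fun _ => lift_h _ _ _, fun _ _ => lift_x _ _ _ _⟩,
    fun θ hθ => algHom_ext (fun i => by rw [hθ.map_h, lift_h]; rfl)
      (fun s i => by rw [hθ.map_x, lift_x]; rfl)⟩

/-! ## The antipode -/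

variable (a d) in
/-- The images of the generators under the antipode (`t = 1`) or its inverse (`t = -1`). -/
def antipodeFamily (t : ℤˣ) : Gen ι → (Uh a d)ᵐᵒᵖ
  | Gen.h i => MulOpposite.op (-h a d i)
  | Gen.x s i =>
      MulOpposite.op ((-qpow ((((t * s : ℤˣ) : ℤ) : ℂ) * (d i : ℂ))) • x a d s i)

/-- The scalars attached to `x_i^+` and `x_i^-` are mutually inverse up to the two signs, so they
cancel in the commutator; its reversal in the opposite ring is matched by the oddness of the
bracket. The Serre sum is homogeneous, so scalars do not affect its vanishing. -/
theorem satisfiesRel_antipodeFamily (t : ℤˣ) : SatisfiesRel a d (antipodeFamily a d t) where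
  hh i j := by
    have : h a d i * h a d j = h a d j * h a d i := satisfiesRel_gens.hh i j
    simp only [antipodeFamily, ← MulOpposite.op_mul, neg_mul_neg, this]
  hx s i j := by
    have : h a d i * x a d s j - x a d s j * h a d i = _ := satisfiesRel_gens.hx s i j
    simp only [antipodeFamily, ← MulOpposite.op_mul, ← MulOpposite.op_sub, ← MulOpposite.op_smul]
    rw [smul_mul_assoc, mul_smul_comm, ← smul_sub, mul_neg, neg_mul, sub_neg_eq_add,
      neg_add_eq_sub, this, smul_comm]
    rfl
  xx i := by
    have : x a d 1 i * x a d (-1) i - x a d (-1) i * x a d 1 i = bracket (d i) (h a d i) :=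
      satisfiesRel_gens.xx i
    simp only [antipodeFamily, ← MulOpposite.op_mul, ← MulOpposite.op_sub, bracket_op]
    rw [bracket_neg, ← this, smul_mul_smul_comm, smul_mul_smul_comm, neg_mul_neg, neg_mul_neg,
      ← qpow_add, ← qpow_add]
    simp [qpow_zero]
  xx_ne i j hij := by
    have : x a d 1 i * x a d (-1) j = x a d (-1) j * x a d 1 i := satisfiesRel_gens.xx_ne i j hij
    simp only [antipodeFamily, ← MulOpposite.op_mul]
    rw [smul_mul_smul_comm, smul_mul_smul_comm, this, mul_comm]
  serre s i j hij := by
    have : serreSum (d i) (1 - a i j).toNat (x a d s i) (x a d s j) = 0 :=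
      satisfiesRel_gens.serre s i j hij
    simp only [antipodeFamily]
    rw [serreSum_op, serreSum_smul, this, smul_zero, smul_zero, MulOpposite.op_zero]

variable (a d) in
/-- The antipode (`t = 1`) and its inverse (`t = -1`). -/
def antipodeFun (t : ℤˣ) (y : Uh a d) : Uh a d :=
  (lift _ (satisfiesRel_antipodeFamily (a := a) (d := d) t) y).unop

theorem isSemiAntiHom_antipodeFun (t : ℤˣ) :
    IsSemiAntiHom (RingHom.id _) (antipodeFun a d t) :=
  (AlgHom.isSemiHom _).unop

theorem antipodeFun_h (t : ℤˣ) (i : ι) : antipodeFun a d t (h a d i) = -h a d i := by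
  rw [antipodeFun, lift_h]; rfl

theorem antipodeFun_x (t s : ℤˣ) (i : ι) : antipodeFun a d t (x a d s i) =
    (-qpow ((((t * s : ℤˣ) : ℤ) : ℂ) * (d i : ℂ))) • x a d s i := by
  rw [antipodeFun, lift_x]; rfl

/-- A composite of two antihomomorphisms is a homomorphism, and this one fixes the generators. The
cases `t = 1` and `t = -1` make the antipode bijective. -/
theorem antipodeFun_neg (t : ℤˣ) (y : Uh a d) : antipodeFun a d t (antipodeFun a d (-t) y) = y := by
  refine isSemiHom_ext (c := 1) (by simp)
    ((isSemiAntiHom_antipodeFun t).comp (isSemiAntiHom_antipodeFun (-t)) fun _ => rfl)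
    isSemiHom_id (fun i => ?_) (fun s i => ?_) y
  · have := (isSemiAntiHom_antipodeFun (a := a) (d := d) t).map_smul (-1) (h a d i)
    simp only [RingHom.id_apply, neg_smul, one_smul] at this
    rw [antipodeFun_h, this, antipodeFun_h, neg_neg]
  · rw [antipodeFun_x, (isSemiAntiHom_antipodeFun t).map_smul, antipodeFun_x, smul_smul]
    simp only [RingHom.id_apply, neg_mul_neg, ← qpow_add]
    simp [qpow_zero]

variable (a d) in
/-- The antipode. -/
def antipode : Uh a d ≃ₗ[ℂ⟦X⟧] Uh a d where
  toFun := antipodeFun a d 1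
  invFun := antipodeFun a d (-1)
  map_add' := (isSemiAntiHom_antipodeFun 1).map_add
  map_smul' := (isSemiAntiHom_antipodeFun 1).map_smul
  left_inv y := by simpa using antipodeFun_neg (-1) y
  right_inv y := antipodeFun_neg 1 y

theorem isAntipode_antipode : IsAntipode (antipode a d) where
  map_one := (isSemiAntiHom_antipodeFun 1).map_one
  map_mul := (isSemiAntiHom_antipodeFun 1).map_mul
  map_h := antipodeFun_h 1
  map_x s i := by
    rw [← neg_smul]
    exact (antipodeFun_x 1 s i).trans (by rw [one_mul])

theorem IsAntipode.isSemiAntiHom {S : Uh a d ≃ₗ[ℂ⟦X⟧] Uh a d} (hS : IsAntipode S) :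
    IsSemiAntiHom (RingHom.id _) S :=
  ⟨map_add S, map_smul S, hS.map_one, hS.map_mul⟩

theorem existsUnique_isAntipode : ∃! S : Uh a d ≃ₗ[ℂ⟦X⟧] Uh a d, IsAntipode S :=
  ⟨antipode a d, isAntipode_antipode, fun _ hS => LinearEquiv.ext fun y =>
    isSemiAntiHom_ext (c := 1) (by simp) hS.isSemiAntiHom isAntipode_antipode.isSemiAntiHom
      (fun i => (hS.map_h i).trans (isAntipode_antipode.map_h i).symm)
      (fun s i => (hS.map_x s i).trans (isAntipode_antipode.map_x s i).symm) y⟩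

/-! ## The comultiplication -/

variable (a d) in
/-- The completion map as an algebra homomorphism. -/
def coeAlgHom : Tensor a d →ₐ[ℂ⟦X⟧] CTensor a d :=
  { (UniformSpace.Completion.coeRingHom : Tensor a d →+* CTensor a d) with
    commutes' := fun _ => rfl }

variable (a d) in
/-- The embedding `y ↦ y ⊗ 1`. -/
def inl : Uh a d →ₐ[ℂ⟦X⟧] CTensor a d :=
  (coeAlgHom a d).comp Algebra.TensorProduct.includeLeft

variable (a d) in
/-- The embedding `y ↦ 1 ⊗ y`. -/
def inr : Uh a d →ₐ[ℂ⟦X⟧] CTensor a d :=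
  (coeAlgHom a d).comp Algebra.TensorProduct.includeRight

theorem inl_apply (y : Uh a d) : inl a d y = ctmul y 1 := rfl

theorem inr_apply (y : Uh a d) : inr a d y = ctmul 1 y := rfl

theorem ctmul_mul (y z y' z' : Uh a d) :
    ctmul y z * ctmul y' z' = ctmul (y * y') (z * z') := by
  rw [ctmul, ctmul, ctmul, ← UniformSpace.Completion.coe_mul, Algebra.TensorProduct.tmul_mul_tmul]

theorem inl_mul_inr (y z : Uh a d) : inl a d y * inr a d z = ctmul y z := by
  rw [inl_apply, inr_apply, ctmul_mul, mul_one, one_mul]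

theorem commute_inl_inr (y z : Uh a d) : Commute (inl a d y) (inr a d z) := by
  rw [Commute, SemiconjBy, inl_apply, inr_apply, ctmul_mul, ctmul_mul, mul_one, one_mul, mul_one,
    one_mul]

theorem cartanExp_map {R : Type*} [Ring R] [Algebra ℂ⟦X⟧ R] [IsHComplete R]
    (φ : Uh a d →ₐ[ℂ⟦X⟧] R) (c : ℂ) (i : ι) :
    cartanExp d (fun g => φ (gens a d g)) c i = φ (qh a d c i) := by
  rw [qh_eq, cartanExp, cartanExp, map_hexp]

/-- The comultiplication formula is applied to the two commuting copies `y ⊗ 1` and `1 ⊗ y` of the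
generators in the completed tensor product. -/
theorem existsUnique_isComul (hdiag : ∀ i, a i i = 2) (hneg : ∀ i j, i ≠ j → a i j ≤ 0)
    (hsymm : ∀ i j, (d i : ℤ) * a i j = (d j : ℤ) * a j i) :
    ∃! Δ : Uh a d →ₐ[ℂ⟦X⟧] CTensor a d, IsComul Δ := by
  have hf := SatisfiesRel.coproduct ((satisfiesRel_gens (a := a) (d := d)).map (inl a d))
    ((satisfiesRel_gens (a := a) (d := d)).map (inr a d))
    (fun _ _ => commute_inl_inr _ _) hsymm hdiag hneg
  have hΔ : IsComul (lift _ hf) := by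
    refine ⟨fun i => lift_h _ _ _, fun s i => ?_⟩
    rw [lift_x, coproductFamily, cartanExp_map, cartanExp_map]
    simp only [gens, inl_mul_inr]
  exact ⟨_, hΔ, fun Δ h => algHom_ext (fun i => (h.map_h i).trans (hΔ.map_h i).symm)
    (fun s i => (h.map_x s i).trans (hΔ.map_x s i).symm)⟩

end Uh

/-! ## Continuity of semilinear maps -/

/-- Since `σ h` is a multiple of `h`, the image of `hⁿ A` lies in `hⁿ B`. -/
theorem continuous_of_semilinear {A B : Type*} [Ring A] [Algebra ℂ⟦X⟧ A] [Ring B] [Algebra ℂ⟦X⟧ B]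
    {σ : ℂ⟦X⟧ →+* ℂ⟦X⟧} {c : ℂ⟦X⟧} (hσ : σ PowerSeries.X = PowerSeries.X * c)
    (φ : A →ₛₗ[σ] B) : @Continuous A B (hTopology A) (hTopology B) φ := by
  let := hTopology A
  let := hTopology B
  have := hTopology_isTopologicalRing A
  have := hTopology_isTopologicalRing B
  refine continuous_of_continuousAt_zero φ.toAddMonoidHom ?_
  change Filter.Tendsto φ (nhds 0) (nhds (φ 0))
  rw [map_zero]
  refine (((hPow_basis A).hasBasis_nhds_zero).tendsto_iff (hPow_basis B).hasBasis_nhds_zero).2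
    fun n _ => ⟨n, trivial, fun y hy => ?_⟩
  obtain ⟨b, rfl⟩ := mem_hPow.1 hy
  refine mem_hPow.2 ⟨c ^ n • φ b, ?_⟩
  rw [map_smulₛₗ, map_pow, hσ, mul_pow, mul_smul]

namespace Uh

variable {ι : Type*} {a : ι → ι → ℤ} {d : ι → ℕ}

theorem uniformContinuous_tensor_tensor {σ : ℂ⟦X⟧ →+* ℂ⟦X⟧} {c : ℂ⟦X⟧}
    (hσ : σ PowerSeries.X = PowerSeries.X * c) (φ : Tensor a d →ₛₗ[σ] Tensor a d) :
    UniformContinuous φ :=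
  uniformContinuous_addMonoidHom_of_continuous (f := φ.toAddMonoidHom)
    (continuous_of_semilinear hσ φ)

theorem uniformContinuous_tensor_uh (φ : Tensor a d →ₗ[ℂ⟦X⟧] Uh a d) : UniformContinuous φ :=
  uniformContinuous_addMonoidHom_of_continuous (f := φ.toAddMonoidHom)
    (continuous_of_semilinear (c := 1) (by simp) φ)

theorem continuous_uh {σ : ℂ⟦X⟧ →+* ℂ⟦X⟧} {c : ℂ⟦X⟧}
    (hσ : σ PowerSeries.X = PowerSeries.X * c) (φ : Uh a d →ₛₗ[σ] Uh a d) : Continuous φ :=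
  continuous_of_semilinear hσ φ

/-! ## Maps on the completed tensor product -/

section Map

variable {σ : ℂ⟦X⟧ →+* ℂ⟦X⟧} {c : ℂ⟦X⟧} (hσ : σ PowerSeries.X = PowerSeries.X * c)
include hσ

theorem map_coe_of_semilinear (φ : Tensor a d →ₛₗ[σ] Tensor a d) (t : Tensor a d) :
    UniformSpace.Completion.map φ (t : CTensor a d) = (φ t : CTensor a d) :=
  UniformSpace.Completion.map_coe (uniformContinuous_tensor_tensor hσ φ) t

theorem map_add_of_semilinear (φ : Tensor a d →ₛₗ[σ] Tensor a d) (t u : CTensor a d) :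
    UniformSpace.Completion.map φ (t + u) =
      UniformSpace.Completion.map φ t + UniformSpace.Completion.map φ u := by
  induction t, u using UniformSpace.Completion.induction_on₂ with
  | hp =>
    have := UniformSpace.Completion.continuous_map (f := φ)
    exact isClosed_eq (by fun_prop) (by fun_prop)
  | ih t u =>
    rw [← UniformSpace.Completion.coe_add, map_coe_of_semilinear hσ, map_coe_of_semilinear hσ,
      map_coe_of_semilinear hσ, map_add, UniformSpace.Completion.coe_add]

theorem map_smul_of_semilinear (φ : Tensor a d →ₛₗ[σ] Tensor a d) (r : ℂ⟦X⟧) (t : CTensor a d) :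
    UniformSpace.Completion.map φ (r • t) = σ r • UniformSpace.Completion.map φ t := by
  induction t using UniformSpace.Completion.induction_on with
  | hp =>
    have := UniformSpace.Completion.continuous_map (f := φ)
    exact isClosed_eq (this.comp (continuous_const_smul _))
      ((continuous_const_smul (σ r)).comp this)
  | ih t =>
    rw [← UniformSpace.Completion.coe_smul, map_coe_of_semilinear hσ, map_coe_of_semilinear hσ,
      map_smulₛₗ, UniformSpace.Completion.coe_smul]

theorem tmap_coe (φ : Uh a d →ₛₗ[σ] Uh a d) (t : Tensor a d) :
    tmap φ (t : CTensor a d) = (TensorProduct.map φ φ t : Tensor a d) :=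
  map_coe_of_semilinear hσ _ t

theorem tmap_ctmul (φ : Uh a d →ₛₗ[σ] Uh a d) (y z : Uh a d) :
    tmap φ (ctmul y z) = ctmul (φ y) (φ z) := by
  rw [ctmul, tmap_coe hσ, TensorProduct.map_tmul, ctmul]

theorem isSemiHom_tmap (φ : Uh a d →ₛₗ[σ] Uh a d) (hφ : IsSemiHom σ φ) :
    IsSemiHom σ (tmap φ) where
  map_add := map_add_of_semilinear hσ _
  map_smul := map_smul_of_semilinear hσ _
  map_one := by
    change tmap φ (ctmul 1 1) = ctmul 1 1
    rw [tmap_ctmul hσ, hφ.map_one]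
  map_mul t u := by
    induction t, u using UniformSpace.Completion.induction_on₂ with
    | hp =>
      have : Continuous (tmap φ) := UniformSpace.Completion.continuous_map
      exact isClosed_eq (by fun_prop) (by fun_prop)
    | ih t u =>
      rw [← UniformSpace.Completion.coe_mul, tmap_coe hσ, tmap_coe hσ, tmap_coe hσ,
        ← UniformSpace.Completion.coe_mul]
      congr 1
      induction t using TensorProduct.induction_on with
      | zero => simp
      | add t t' h h' => rw [add_mul, map_add, h, h', map_add, add_mul]
      | tmul y z =>
        induction u using TensorProduct.induction_on with
        | zero => simp
        | add t t' h h' => rw [mul_add, map_add, h, h', map_add, mul_add]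
        | tmul y' z' =>
          simp [Algebra.TensorProduct.tmul_mul_tmul, TensorProduct.map_tmul, hφ.map_mul]

theorem isSemiAntiHom_tmap (φ : Uh a d →ₛₗ[σ] Uh a d) (hφ : IsSemiAntiHom σ φ) :
    IsSemiAntiHom σ (tmap φ) where
  map_add := map_add_of_semilinear hσ _
  map_smul := map_smul_of_semilinear hσ _
  map_one := by
    change tmap φ (ctmul 1 1) = ctmul 1 1
    rw [tmap_ctmul hσ, hφ.map_one]
  map_mul t u := by
    induction t, u using UniformSpace.Completion.induction_on₂ with
    | hp =>
      have : Continuous (tmap φ) := UniformSpace.Completion.continuous_map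
      exact isClosed_eq (by fun_prop) (by fun_prop)
    | ih t u =>
      rw [← UniformSpace.Completion.coe_mul, tmap_coe hσ, tmap_coe hσ, tmap_coe hσ,
        ← UniformSpace.Completion.coe_mul]
      congr 1
      induction t using TensorProduct.induction_on with
      | zero => simp
      | add t t' h h' => rw [add_mul, map_add, h, h', map_add, mul_add]
      | tmul y z =>
        induction u using TensorProduct.induction_on with
        | zero => simp
        | add t t' h h' => rw [mul_add, map_add, h, h', map_add, add_mul]
        | tmul y' z' =>
          simp [Algebra.TensorProduct.tmul_mul_tmul, TensorProduct.map_tmul, hφ.map_mul]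

end Map

theorem flip_coe (t : Tensor a d) :
    flip (t : CTensor a d) = (TensorProduct.comm ℂ⟦X⟧ (Uh a d) (Uh a d) t : Tensor a d) :=
  map_coe_of_semilinear (σ := RingHom.id _) (c := 1) (by simp)
    (TensorProduct.comm ℂ⟦X⟧ (Uh a d) (Uh a d)).toLinearMap t

theorem flip_ctmul (y z : Uh a d) : flip (ctmul y z) = ctmul z y := by
  rw [ctmul, flip_coe, TensorProduct.comm_tmul, ctmul]

theorem isSemiHom_flip : IsSemiHom (RingHom.id _) (flip : CTensor a d → CTensor a d) where
  map_add := map_add_of_semilinear (σ := RingHom.id _) (c := 1) (by simp)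
    (TensorProduct.comm ℂ⟦X⟧ (Uh a d) (Uh a d)).toLinearMap
  map_smul := map_smul_of_semilinear (σ := RingHom.id _) (c := 1) (by simp)
    (TensorProduct.comm ℂ⟦X⟧ (Uh a d) (Uh a d)).toLinearMap
  map_one := flip_ctmul 1 1
  map_mul t u := by
    induction t, u using UniformSpace.Completion.induction_on₂ with
    | hp =>
      have : Continuous (flip : CTensor a d → CTensor a d) := UniformSpace.Completion.continuous_map
      exact isClosed_eq (by fun_prop) (by fun_prop)
    | ih t u =>
      rw [← UniformSpace.Completion.coe_mul, flip_coe, flip_coe, flip_coe,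
        ← UniformSpace.Completion.coe_mul]
      congr 1
      exact map_mul (Algebra.TensorProduct.comm ℂ⟦X⟧ (Uh a d) (Uh a d)) t u

theorem continuous_flip : Continuous (flip : CTensor a d → CTensor a d) :=
  UniformSpace.Completion.continuous_map

theorem continuous_tmap {σ : ℂ⟦X⟧ →+* ℂ⟦X⟧} (φ : Uh a d →ₛₗ[σ] Uh a d) : Continuous (tmap φ) :=
  UniformSpace.Completion.continuous_map

/-- Continuous additive maps on the completed tensor product agree if they agree on pure tensors. -/
theorem cTensor_ext {B : Type*} [AddCommGroup B] [TopologicalSpace B] [T2Space B]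
    {F G : CTensor a d → B} (hF : Continuous F) (hG : Continuous G)
    (hFa : ∀ t u, F (t + u) = F t + F u) (hGa : ∀ t u, G (t + u) = G t + G u)
    (h : ∀ y z, F (ctmul y z) = G (ctmul y z)) (t : CTensor a d) : F t = G t := by
  induction t using UniformSpace.Completion.induction_on with
  | hp => exact isClosed_eq hF hG
  | ih t =>
    induction t using TensorProduct.induction_on with
    | zero =>
      have := h 0 0
      rwa [ctmul, TensorProduct.zero_tmul] at this
    | tmul y z => exact h y z
    | add t u ht hu => rw [UniformSpace.Completion.coe_add, hFa, hGa, ht, hu]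

theorem flip_tmap {σ : ℂ⟦X⟧ →+* ℂ⟦X⟧} {c : ℂ⟦X⟧} (hσ : σ PowerSeries.X = PowerSeries.X * c)
    (φ : Uh a d →ₛₗ[σ] Uh a d) (t : CTensor a d) : flip (tmap φ t) = tmap φ (flip t) := by
  refine cTensor_ext (F := fun t => flip (tmap φ t)) (G := fun t => tmap φ (flip t))
    (continuous_flip.comp (continuous_tmap φ)) ((continuous_tmap φ).comp continuous_flip)
    (fun t u => ?_) (fun t u => ?_) (fun y z => ?_) t
  · exact (congrArg flip (map_add_of_semilinear hσ _ t u)).trans (isSemiHom_flip.map_add _ _)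
  · exact (congrArg (tmap φ) (isSemiHom_flip.map_add t u)).trans
      (map_add_of_semilinear hσ _ _ _)
  · simp only [tmap_ctmul hσ, flip_ctmul]

theorem flip_flip (t : CTensor a d) : flip (flip t) = t := by
  refine cTensor_ext (F := fun t => flip (flip t)) (G := fun t => t)
    (continuous_flip.comp continuous_flip) continuous_id
    (fun t u => ?_) (fun t u => rfl) (fun y z => ?_) t
  · simp only [isSemiHom_flip.map_add]
  · simp only [flip_ctmul]

/-! ## The adjoint action -/

/-- The continuous extension of `u ⊗ v ↦ u z T(v)`. -/
def sandwich (T : Uh a d →ₗ[ℂ⟦X⟧] Uh a d) (z : Uh a d) : CTensor a d → Uh a d :=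
  UniformSpace.Completion.extension
    (TensorProduct.lift ((LinearMap.mul ℂ⟦X⟧ (Uh a d)).compl₁₂ (LinearMap.mulRight ℂ⟦X⟧ z) T))

theorem continuous_sandwich (T : Uh a d →ₗ[ℂ⟦X⟧] Uh a d) (z : Uh a d) :
    Continuous (sandwich T z) :=
  UniformSpace.Completion.continuous_extension

theorem sandwich_coe (T : Uh a d →ₗ[ℂ⟦X⟧] Uh a d) (z : Uh a d) (t : Tensor a d) :
    sandwich T z t = TensorProduct.lift
      ((LinearMap.mul ℂ⟦X⟧ (Uh a d)).compl₁₂ (LinearMap.mulRight ℂ⟦X⟧ z) T) t :=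
  UniformSpace.Completion.extension_coe (uniformContinuous_tensor_uh _) t

theorem sandwich_ctmul (T : Uh a d →ₗ[ℂ⟦X⟧] Uh a d) (z u v : Uh a d) :
    sandwich T z (ctmul u v) = u * z * T v := by
  rw [ctmul, sandwich_coe]
  simp

theorem sandwich_add (T : Uh a d →ₗ[ℂ⟦X⟧] Uh a d) (z : Uh a d) (t u : CTensor a d) :
    sandwich T z (t + u) = sandwich T z t + sandwich T z u := by
  induction t, u using UniformSpace.Completion.induction_on₂ with
  | hp =>
    have := continuous_sandwich T z
    exact isClosed_eq (by fun_prop) (by fun_prop)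
  | ih t u =>
    rw [← UniformSpace.Completion.coe_add, sandwich_coe, sandwich_coe, sandwich_coe, map_add]

theorem ad_eq (Δ : Uh a d →ₐ[ℂ⟦X⟧] CTensor a d) (S : Uh a d ≃ₗ[ℂ⟦X⟧] Uh a d) (y z : Uh a d) :
    ad Δ S y z = sandwich S.toLinearMap z (Δ y) := rfl

theorem ad'_eq (Δ : Uh a d →ₐ[ℂ⟦X⟧] CTensor a d) (S : Uh a d ≃ₗ[ℂ⟦X⟧] Uh a d) (y z : Uh a d) :
    ad' Δ S y z = sandwich S.symm.toLinearMap z (flip (Δ y)) := rfl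

/-- A homomorphism that intertwines `T` and `T'` intertwines the associated sandwich maps. -/
theorem sandwich_tmap {σ : ℂ⟦X⟧ →+* ℂ⟦X⟧} {c : ℂ⟦X⟧} (hσ : σ PowerSeries.X = PowerSeries.X * c)
    (φ : Uh a d →ₛₗ[σ] Uh a d) (hφ : IsSemiHom σ φ) {T T' : Uh a d →ₗ[ℂ⟦X⟧] Uh a d}
    (hT : ∀ y, T' (φ y) = φ (T y)) (z : Uh a d) (t : CTensor a d) :
    sandwich T' (φ z) (tmap φ t) = φ (sandwich T z t) := by
  refine cTensor_ext (F := fun t => sandwich T' (φ z) (tmap φ t))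
    (G := fun t => φ (sandwich T z t))
    ((continuous_sandwich _ _).comp (continuous_tmap φ))
    ((continuous_uh hσ φ).comp (continuous_sandwich _ _))
    (fun t u => ?_) (fun t u => ?_) (fun u v => ?_) t
  · exact (congrArg _ (map_add_of_semilinear hσ _ t u)).trans (sandwich_add _ _ _ _)
  · simp only [sandwich_add, map_add]
  · simp only [tmap_ctmul hσ, sandwich_ctmul, hT, hφ.map_mul]

/-- The analogue of `sandwich_tmap` for antihomomorphisms. -/
theorem sandwich_tmap_anti {σ : ℂ⟦X⟧ →+* ℂ⟦X⟧} {c : ℂ⟦X⟧}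
    (hσ : σ PowerSeries.X = PowerSeries.X * c) (φ : Uh a d →ₛₗ[σ] Uh a d)
    (hφ : IsSemiAntiHom σ φ) {T T' : Uh a d →ₗ[ℂ⟦X⟧] Uh a d} {ψ : Uh a d →ₗ[ℂ⟦X⟧] Uh a d}
    (hT : ∀ y, T' (φ y) = φ (ψ y)) (hψ : ∀ y, T (ψ y) = y) (z : Uh a d) (t : CTensor a d) :
    sandwich T' (φ z) (tmap φ t) = φ (sandwich T z (flip (tmap ψ t))) := by
  have h1 : (RingHom.id ℂ⟦X⟧) PowerSeries.X = PowerSeries.X * 1 := by simp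
  refine cTensor_ext (F := fun t => sandwich T' (φ z) (tmap φ t))
    (G := fun t => φ (sandwich T z (flip (tmap ψ t))))
    ((continuous_sandwich _ _).comp (continuous_tmap φ))
    ((continuous_uh hσ φ).comp ((continuous_sandwich _ _).comp
      (continuous_flip.comp (continuous_tmap ψ))))
    (fun t u => ?_) (fun t u => ?_) (fun u v => ?_) t
  · exact (congrArg _ (map_add_of_semilinear hσ _ t u)).trans (sandwich_add _ _ _ _)
  · have : tmap ψ (t + u) = tmap ψ t + tmap ψ u := map_add_of_semilinear h1 _ t u
    simp only [this, isSemiHom_flip.map_add, sandwich_add, map_add]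
  -- On `u ⊗ v` both sides equal `φ(ψ(v) z u)`: on the left `φ` reverses the product `φ(u) φ(z)
  -- φ(ψ(v))`, and on the right `T` cancels `ψ` on `u`.
  · simp only [tmap_ctmul hσ, tmap_ctmul h1, flip_ctmul, sandwich_ctmul, hT, hψ, hφ.map_mul,
      mul_assoc]

end Uh

theorem id_X : RingHom.id ℂ⟦X⟧ PowerSeries.X = PowerSeries.X * 1 := by simp

theorem hexp_op {R : Type*} [Ring R] [Algebra ℂ⟦X⟧ R] [IsHComplete R] (c : ℂ) (r : R) :
    hexp c (MulOpposite.op r) = MulOpposite.op (hexp c r) := by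
  rw [hexp, hexp, ← hEval_op]
  congr 1
  ext n
  simp [expSeries]

/-- A linear unital ring homomorphism as an algebra homomorphism. -/
def IsSemiHom.toAlgHom {A B : Type*} [Ring A] [Algebra ℂ⟦X⟧ A] [Ring B] [Algebra ℂ⟦X⟧ B]
    {φ : A → B} (hφ : IsSemiHom (RingHom.id _) φ) : A →ₐ[ℂ⟦X⟧] B :=
  { hφ.toRingHom with
    commutes' := fun c => by
      have h := hφ.map_smul c 1
      rw [hφ.map_one] at h
      rw [Algebra.algebraMap_eq_smul_one, Algebra.algebraMap_eq_smul_one]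
      exact h }

theorem qconjSemiHom : IsSemiHom qconj qconj :=
  ⟨map_add qconj, fun c y => map_mul qconj c y, map_one qconj, map_mul qconj⟩

namespace Uh

variable {ι : Type*} {a : ι → ι → ℤ} {d : ι → ℕ}

theorem ctmul_smul_left (c : ℂ⟦X⟧) (y z : Uh a d) : ctmul (c • y) z = c • ctmul y z := by
  rw [ctmul, ctmul, ← UniformSpace.Completion.coe_smul, TensorProduct.smul_tmul']

theorem ctmul_smul_right (c : ℂ⟦X⟧) (y z : Uh a d) : ctmul y (c • z) = c • ctmul y z := by
  rw [ctmul, ctmul, ← UniformSpace.Completion.coe_smul, TensorProduct.tmul_smul]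

theorem ctmul_neg_left (y z : Uh a d) : ctmul (-y) z = -ctmul y z := by
  simpa using ctmul_smul_left (-1) y z

theorem ctmul_neg_right (y z : Uh a d) : ctmul y (-z) = -ctmul y z := by
  simpa using ctmul_smul_right (-1) y z

/-! ### Action on `q_i^{c h_i}`, and relations among the antipode, the Cartan involution and
conjugation. -/

section Maps

variable {S : Uh a d ≃ₗ[ℂ⟦X⟧] Uh a d} {θ : Uh a d →ₐ[ℂ⟦X⟧] Uh a d} {κ : Uh a d →ₛₗ[qconj] Uh a d}

theorem qh_eq_hexp (c : ℂ) (i : ι) : qh a d c i = hexp (c * d i) (h a d i) := qh_eq c i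

theorem IsQConj.map_qh (hκ : IsQConj κ) (c : ℂ) (i : ι) : κ (qh a d c i) = qh a d (-c) i := by
  rw [existsUnique_isQConj.unique hκ isQConj_conj, qh, conj_mk, negVar_qpowH, qh, neg_mul]

theorem IsCartanInvolution.map_qh (hθ : IsCartanInvolution θ) (c : ℂ) (i : ι) :
    θ (qh a d c i) = qh a d (-c) i := by
  rw [qh_eq_hexp, map_hexp, hθ.map_h, hexp_neg, qh_eq_hexp, neg_mul]

/-- The exponential involves only powers of one element, so reversing products does not change it
and only the sign of `h_i` matters. -/
theorem map_qh_of_anti {φ : Uh a d → Uh a d} (hφ : IsSemiAntiHom (RingHom.id _) φ) {i : ι}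
    (h : φ (h a d i) = -Uh.h a d i) (c : ℂ) : φ (qh a d c i) = qh a d (-c) i := by
  have h1 := map_hexp hφ.op.toAlgHom (c * d i) (Uh.h a d i)
  have h2 : hφ.op.toAlgHom (Uh.h a d i) = MulOpposite.op (-Uh.h a d i) := congrArg _ h
  rw [h2, hexp_op, hexp_neg] at h1
  rw [qh_eq_hexp, qh_eq_hexp, neg_mul]
  exact MulOpposite.op_injective h1

theorem IsAntipode.isSemiAntiHom_symm (hS : IsAntipode S) :
    IsSemiAntiHom (RingHom.id _) S.symm :=
  ⟨map_add S.symm, map_smul S.symm, by rw [LinearEquiv.symm_apply_eq, hS.map_one], fun y z => by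
    rw [LinearEquiv.symm_apply_eq, hS.map_mul, S.apply_symm_apply, S.apply_symm_apply]⟩

theorem IsAntipode.map_x' (hS : IsAntipode S) (s : ℤˣ) (i : ι) :
    S (x a d s i) = (-qpow (((s : ℤ) : ℂ) * d i)) • x a d s i := by
  rw [hS.map_x, neg_smul]

theorem IsAntipode.symm_h (hS : IsAntipode S) (i : ι) : S.symm (h a d i) = -h a d i := by
  rw [LinearEquiv.symm_apply_eq, map_neg, hS.map_h, neg_neg]

theorem IsAntipode.symm_x (hS : IsAntipode S) (s : ℤˣ) (i : ι) :
    S.symm (x a d s i) = (-qpow (-(((s : ℤ) : ℂ) * d i))) • x a d s i := by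
  rw [LinearEquiv.symm_apply_eq, map_smul, hS.map_x', smul_smul, neg_mul_neg, ← qpow_add,
    neg_add_cancel, qpow_zero, one_smul]

theorem IsQConj.involutive (hκ : IsQConj κ) : Function.Involutive κ :=
  isSemiHom_ext id_X (hκ.isSemiHom.comp hκ.isSemiHom fun c => qconj_qconj c) isSemiHom_id
    (fun i => by rw [hκ.map_h, hκ.map_h]) (fun s i => by rw [hκ.map_x, hκ.map_x])

theorem IsCartanInvolution.involutive (hθ : IsCartanInvolution θ) : Function.Involutive θ :=
  isSemiHom_ext id_X ((AlgHom.isSemiHom θ).comp (AlgHom.isSemiHom θ) fun _ => rfl) isSemiHom_id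
    (fun i => by rw [hθ.map_h, map_neg, hθ.map_h, neg_neg])
    (fun s i => by rw [hθ.map_x, hθ.map_x, neg_neg])

/-- On `x_i^±` conjugation replaces the factor `-q_i^{±1}` of `S` by its inverse, which is the
factor of `S⁻¹`. -/
theorem IsAntipode.map_conj (hS : IsAntipode S) (hκ : IsQConj κ) (y : Uh a d) :
    S (κ y) = κ (S.symm y) := by
  refine isSemiAntiHom_ext qconj_X (hS.isSemiAntiHom.comp_hom hκ.isSemiHom fun _ => rfl)
    (hκ.isSemiHom.comp_anti hS.isSemiAntiHom_symm fun _ => rfl) (fun i => ?_) (fun s i => ?_) y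
  · rw [hκ.map_h, hS.map_h, hS.symm_h, map_neg, hκ.map_h]
  · rw [hκ.map_x, hS.map_x', hS.symm_x, map_smulₛₗ, hκ.map_x, map_neg, qconj_qpow, neg_neg]

theorem IsQConj.isSemiHom_comp (hκ : IsQConj κ) (θ : Uh a d →ₐ[ℂ⟦X⟧] Uh a d) :
    IsSemiHom qconj (κ.comp θ.toLinearMap) :=
  hκ.isSemiHom.comp (AlgHom.isSemiHom θ) fun _ => rfl

theorem IsAntipode.isSemiAntiHom_conj_comp (hS : IsAntipode S) (hκ : IsQConj κ) :
    IsSemiAntiHom qconj (κ.comp S.toLinearMap) :=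
  hκ.isSemiHom.comp_anti hS.isSemiAntiHom fun _ => rfl

theorem conj_cartan_apply (y : Uh a d) : (κ.comp θ.toLinearMap) y = κ (θ y) := rfl

theorem conj_antipode_apply (y : Uh a d) : (κ.comp S.toLinearMap) y = κ (S y) := rfl

theorem IsAntipode.map_conj_cartan (hS : IsAntipode S) (hθ : IsCartanInvolution θ)
    (hκ : IsQConj κ) (y : Uh a d) : S (κ (θ y)) = κ (θ (S y)) := by
  refine isSemiAntiHom_ext qconj_X
    (hS.isSemiAntiHom.comp_hom (hκ.isSemiHom_comp θ) fun _ => rfl)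
    ((hκ.isSemiHom_comp θ).comp_anti hS.isSemiAntiHom fun _ => rfl)
    (fun i => ?_) (fun s i => ?_) y
  · simp only [conj_cartan_apply, hθ.map_h, hS.map_h, map_neg, hκ.map_h]
  · rw [hS.map_x', conj_cartan_apply, conj_cartan_apply, hθ.map_x, hκ.map_x, hS.map_x', map_smul,
      hθ.map_x, map_smulₛₗ, hκ.map_x, map_neg, qconj_qpow]
    simp

end Maps

/-! ### Compatibility with comultiplication and counit, and the assertions (a) to (d). -/

section Comul

variable {Δ : Uh a d →ₐ[ℂ⟦X⟧] CTensor a d} {ε : Uh a d →ₐ[ℂ⟦X⟧] ℂ⟦X⟧}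
  {S : Uh a d ≃ₗ[ℂ⟦X⟧] Uh a d} {θ : Uh a d →ₐ[ℂ⟦X⟧] Uh a d} {κ : Uh a d →ₛₗ[qconj] Uh a d}

/-- Conjugation exchanges `q_i^{h_i/2}` and `q_i^{-h_i/2}`, and the flip restores the shape of
`Δ(x_i^±)`. -/
theorem IsComul.map_conj (hΔ : IsComul Δ) (hκ : IsQConj κ) (y : Uh a d) :
    Δ (κ y) = tmap κ (flip (Δ y)) := by
  have ht := isSemiHom_tmap qconj_X κ hκ.isSemiHom
  refine isSemiHom_ext qconj_X ((AlgHom.isSemiHom Δ).comp hκ.isSemiHom fun _ => rfl)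
    (ht.comp (isSemiHom_flip.comp (AlgHom.isSemiHom Δ) fun _ => rfl) fun _ => rfl)
    (fun i => ?_) (fun s i => ?_) y
  · rw [hκ.map_h, hΔ.map_h, isSemiHom_flip.map_add, flip_ctmul, flip_ctmul, ht.map_add,
      tmap_ctmul qconj_X, tmap_ctmul qconj_X, hκ.map_h, hκ.map_one, add_comm]
  · rw [hκ.map_x, hΔ.map_x, isSemiHom_flip.map_add, flip_ctmul, flip_ctmul, ht.map_add,
      tmap_ctmul qconj_X, tmap_ctmul qconj_X, hκ.map_x, hκ.map_qh, hκ.map_qh, add_comm]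
    congr 3 <;> ring

/-- Both `θ` and conjugation invert `q_i^{c h_i}`, so their composite fixes it. As `Δ(x_i^+)` and
`Δ(x_i^-)` have the same form, exchanging them is harmless and no flip occurs. -/
theorem IsComul.map_conj_cartan (hΔ : IsComul Δ) (hθ : IsCartanInvolution θ) (hκ : IsQConj κ)
    (y : Uh a d) : Δ (κ (θ y)) = tmap (κ.comp θ.toLinearMap) (Δ y) := by
  have ht := isSemiHom_tmap qconj_X _ (hκ.isSemiHom_comp θ)
  refine isSemiHom_ext qconj_X
    ((AlgHom.isSemiHom Δ).comp (hκ.isSemiHom_comp θ) fun _ => rfl)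
    (ht.comp (AlgHom.isSemiHom Δ) fun _ => rfl) (fun i => ?_) (fun s i => ?_) y
  · rw [hΔ.map_h, ht.map_add, tmap_ctmul qconj_X, tmap_ctmul qconj_X]
    simp only [conj_cartan_apply, hθ.map_h, map_neg, hκ.map_h, hΔ.map_h, map_one, hκ.map_one,
      ctmul_neg_left, ctmul_neg_right, neg_add]
  · rw [hΔ.map_x, ht.map_add, tmap_ctmul qconj_X, tmap_ctmul qconj_X]
    simp only [conj_cartan_apply, hθ.map_x, hκ.map_x, hΔ.map_x, hθ.map_qh, hκ.map_qh, neg_neg]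

/-- As with `θ`, the two inversions of `q_i^{c h_i}` cancel, and the scalar acquired by `x_i^±` is
the same on both sides. -/
theorem IsComul.map_conj_antipode (hΔ : IsComul Δ) (hS : IsAntipode S) (hκ : IsQConj κ)
    (y : Uh a d) : Δ (κ (S y)) = tmap (κ.comp S.toLinearMap) (Δ y) := by
  have ht := isSemiAntiHom_tmap qconj_X _ (hS.isSemiAntiHom_conj_comp hκ)
  refine isSemiAntiHom_ext qconj_X
    ((AlgHom.isSemiHom Δ).comp_anti (hS.isSemiAntiHom_conj_comp hκ) fun _ => rfl)
    (ht.comp_hom (AlgHom.isSemiHom Δ) fun _ => rfl) (fun i => ?_) (fun s i => ?_) y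
  · rw [hΔ.map_h, ht.map_add, tmap_ctmul qconj_X, tmap_ctmul qconj_X]
    simp only [conj_antipode_apply, hS.map_h, map_neg, hκ.map_h, hΔ.map_h, hS.map_one, hκ.map_one,
      ctmul_neg_left, ctmul_neg_right, neg_add]
  · rw [hΔ.map_x, ht.map_add, tmap_ctmul qconj_X, tmap_ctmul qconj_X]
    simp only [conj_antipode_apply, hS.map_x', map_smulₛₗ, hκ.map_x, hΔ.map_x,
      map_qh_of_anti hS.isSemiAntiHom (hS.map_h i), hκ.map_qh, neg_neg, ctmul_smul_left,
      ctmul_smul_right, smul_add, RingHom.id_apply]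

/-- The inverse antipode inverts `q_i^{c h_i}` only once, so here the flip is needed. -/
theorem IsComul.map_antipode_symm (hΔ : IsComul Δ) (hS : IsAntipode S) (y : Uh a d) :
    Δ (S.symm y) = flip (tmap S.symm.toLinearMap (Δ y)) := by
  have hS' : IsSemiAntiHom (RingHom.id _) S.symm.toLinearMap := hS.isSemiAntiHom_symm
  have ht := isSemiAntiHom_tmap id_X _ hS'
  refine isSemiAntiHom_ext id_X
    ((AlgHom.isSemiHom Δ).comp_anti hS.isSemiAntiHom_symm fun _ => rfl)
    (isSemiHom_flip.comp_anti (ht.comp_hom (AlgHom.isSemiHom Δ) fun _ => rfl) fun _ => rfl)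
    (fun i => ?_) (fun s i => ?_) y
  · rw [hΔ.map_h, ht.map_add, tmap_ctmul id_X, tmap_ctmul id_X, isSemiHom_flip.map_add,
      flip_ctmul, flip_ctmul, hS'.map_one, LinearEquiv.coe_coe, hS.symm_h, map_neg, hΔ.map_h,
      ctmul_neg_left, ctmul_neg_right, ← neg_add, add_comm]
  · rw [hΔ.map_x, ht.map_add, tmap_ctmul id_X, tmap_ctmul id_X, isSemiHom_flip.map_add,
      flip_ctmul, flip_ctmul, LinearEquiv.coe_coe, hS.symm_x, map_smul, hΔ.map_x,
      map_qh_of_anti hS.isSemiAntiHom_symm (hS.symm_h i),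
      map_qh_of_anti hS.isSemiAntiHom_symm (hS.symm_h i), ctmul_smul_left, ctmul_smul_right,
      ← smul_add, add_comm]
    congr 4 <;> ring

theorem IsCounit.map_conj (hε : IsCounit ε) (hκ : IsQConj κ) (y : Uh a d) :
    ε (κ y) = qconj (ε y) := by
  refine isSemiHom_ext qconj_X ((AlgHom.isSemiHom ε).comp hκ.isSemiHom fun _ => rfl)
    (qconjSemiHom.comp (AlgHom.isSemiHom ε) fun _ => rfl) (fun i => ?_) (fun s i => ?_) y
  · rw [hκ.map_h, hε.map_h, map_zero]
  · rw [hκ.map_x, hε.map_x, map_zero]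

theorem IsCounit.map_cartan (hε : IsCounit ε) (hθ : IsCartanInvolution θ) (y : Uh a d) :
    ε (θ y) = ε y := by
  refine isSemiHom_ext id_X ((AlgHom.isSemiHom ε).comp (AlgHom.isSemiHom θ) fun _ => rfl)
    (AlgHom.isSemiHom ε) (fun i => ?_) (fun s i => ?_) y
  · rw [hθ.map_h, map_neg, hε.map_h, neg_zero]
  · rw [hθ.map_x, hε.map_x, hε.map_x]

theorem isHopfQIso_conj (hΔ : IsComul Δ) (hε : IsCounit ε) (hS : IsAntipode S) (hκ : IsQConj κ) :
    IsHopfQIso Δ ε S (fun y => flip (Δ y)) ε S.symm κ where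
  isAlgQIso := ⟨hκ.involutive.bijective, hκ.map_one, hκ.map_mul⟩
  comul y := by rw [hΔ.map_conj hκ, flip_tmap qconj_X, flip_flip]
  counit := hε.map_conj hκ
  antipode y := by rw [LinearEquiv.symm_apply_eq, hS.map_conj hκ, S.symm_apply_apply]

theorem isHopfQIso_conj_cartan (hΔ : IsComul Δ) (hε : IsCounit ε) (hS : IsAntipode S)
    (hθ : IsCartanInvolution θ) (hκ : IsQConj κ) :
    IsHopfQIso Δ ε S Δ ε S (κ.comp θ.toLinearMap) where
  isAlgQIso := ⟨hκ.involutive.bijective.comp hθ.involutive.bijective,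
    (hκ.isSemiHom_comp θ).map_one, (hκ.isSemiHom_comp θ).map_mul⟩
  comul := hΔ.map_conj_cartan hθ hκ
  counit y := (hε.map_conj hκ (θ y)).trans (by rw [hε.map_cartan hθ])
  antipode := hS.map_conj_cartan hθ hκ

theorem isAlgQAntiIso_conj_antipode (hS : IsAntipode S) (hκ : IsQConj κ) :
    IsAlgQAntiIso (κ.comp S.toLinearMap) :=
  ⟨hκ.involutive.bijective.comp S.bijective, (hS.isSemiAntiHom_conj_comp hκ).map_one,
    (hS.isSemiAntiHom_conj_comp hκ).map_mul⟩

/-- The flip in the definition of `•` cancels the one produced by conjugating `Δ`, and conjugation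
intertwines `S` with `S⁻¹`. -/
theorem ad'_conj (hΔ : IsComul Δ) (hS : IsAntipode S) (hκ : IsQConj κ) (y z : Uh a d) :
    ad' Δ S (κ y) (κ z) = κ (ad Δ S y z) := by
  rw [ad'_eq, ad_eq, hΔ.map_conj hκ, flip_tmap qconj_X, flip_flip]
  refine sandwich_tmap qconj_X κ hκ.isSemiHom (fun v => ?_) z _
  change S.symm (κ v) = κ (S v)
  rw [LinearEquiv.symm_apply_eq, hS.map_conj hκ, S.symm_apply_apply]

theorem ad_conj_cartan (hΔ : IsComul Δ) (hS : IsAntipode S) (hθ : IsCartanInvolution θ)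
    (hκ : IsQConj κ) (y z : Uh a d) :
    ad Δ S (κ (θ y)) (κ (θ z)) = κ (θ (ad Δ S y z)) := by
  rw [ad_eq, ad_eq, hΔ.map_conj_cartan hθ hκ]
  exact sandwich_tmap qconj_X _ (hκ.isSemiHom_comp θ) (hS.map_conj_cartan hθ hκ) z _

/-- Put `φ = κ S`. Then `Δ φ = (φ ⊗ φ) Δ` and `S φ = φ S⁻¹`, so `φ(y) ∘ φ(z) = φ(∑ S⁻¹(y₍₂₎) z
y₍₁₎)`. The inner sum is `S⁻¹(y) ∘ z`, because `S⁻¹` reverses the comultiplication. -/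
theorem ad_conj_antipode (hΔ : IsComul Δ) (hS : IsAntipode S) (hκ : IsQConj κ) (y z : Uh a d) :
    ad Δ S (κ (S y)) (κ (S z)) = κ (S (ad Δ S (S.symm y) z)) := by
  rw [ad_eq, ad_eq, hΔ.map_conj_antipode hS hκ, hΔ.map_antipode_symm hS]
  refine sandwich_tmap_anti qconj_X _ (hS.isSemiAntiHom_conj_comp hκ)
    (ψ := S.symm.toLinearMap) (fun v => ?_) (fun v => S.apply_symm_apply v) z _
  change S (κ (S v)) = κ (S (S.symm v))
  rw [hS.map_conj hκ, S.symm_apply_apply, S.apply_symm_apply]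

end Comul

end Uh

/-! ## The Cartan matrix -/

section Cartan

variable {g : Type*} [LieRing g] [LieAlgebra ℂ g] [FiniteDimensional ℂ g]
  [LieAlgebra.IsSimple ℂ g] {H : LieSubalgebra ℂ g} [H.IsCartanSubalgebra]
  (b : (LieAlgebra.IsKilling.rootSystem H).Base)

theorem cartanMatrix_diag (i : b.support) : cartanMatrix b i i = 2 :=
  b.cartanMatrix_apply_same i

theorem cartanMatrix_nonpos (i j : b.support) (h : i ≠ j) : cartanMatrix b i j ≤ 0 :=
  b.cartanMatrix_le_zero_of_ne j i h.symm

end Cartan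

end QuantumGroup

end

open QuantumGroup Uh in
theorem mainTheorem3 {g : Type*} [LieRing g] [LieAlgebra ℂ g] [FiniteDimensional ℂ g]
    [LieAlgebra.IsSimple ℂ g] (H : LieSubalgebra ℂ g) [H.IsCartanSubalgebra]
    (b : (LieAlgebra.IsKilling.rootSystem H).Base)
    (d : b.support → ℕ) (hd_pos : ∀ i, 0 < d i)
    (hd_coprime : ∀ m : ℕ, (∀ i, m ∣ d i) → m = 1)
    (hd_symm : ∀ i j, (d i : ℤ) * cartanMatrix b i j = (d j : ℤ) * cartanMatrix b j i) :
    -- the structure maps are well defined by their values on the generators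
    (∃! Δ : Uh (cartanMatrix b) d →ₐ[ℂ⟦X⟧] CTensor (cartanMatrix b) d, IsComul Δ) ∧
    (∃! ε : Uh (cartanMatrix b) d →ₐ[ℂ⟦X⟧] ℂ⟦X⟧, IsCounit ε) ∧
    (∃! S : Uh (cartanMatrix b) d ≃ₗ[ℂ⟦X⟧] Uh (cartanMatrix b) d, IsAntipode S) ∧
    (∃! θ : Uh (cartanMatrix b) d →ₐ[ℂ⟦X⟧] Uh (cartanMatrix b) d, IsCartanInvolution θ) ∧
    (∃! κ : Uh (cartanMatrix b) d →ₛₗ[qconj] Uh (cartanMatrix b) d, IsQConj κ) ∧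
    ∀ (Δ : Uh (cartanMatrix b) d →ₐ[ℂ⟦X⟧] CTensor (cartanMatrix b) d)
      (ε : Uh (cartanMatrix b) d →ₐ[ℂ⟦X⟧] ℂ⟦X⟧)
      (S : Uh (cartanMatrix b) d ≃ₗ[ℂ⟦X⟧] Uh (cartanMatrix b) d)
      (θ : Uh (cartanMatrix b) d →ₐ[ℂ⟦X⟧] Uh (cartanMatrix b) d)
      (κ : Uh (cartanMatrix b) d →ₛₗ[qconj] Uh (cartanMatrix b) d),
      IsComul Δ → IsCounit ε → IsAntipode S → IsCartanInvolution θ → IsQConj κ →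
      -- (a)
      (IsHopfQIso Δ ε S (fun y => flip (Δ y)) ε S.symm κ ∧
        (∀ y, ε (κ y) = qconj (ε y)) ∧
        (∀ y, Δ (κ y) = tmap κ (flip (Δ y))) ∧
        (∀ y, S (κ y) = κ (S.symm y))) ∧
      -- (b)
      (∀ y z, ad' Δ S (κ y) (κ z) = κ (ad Δ S y z)) ∧
      -- (c)
      (IsHopfQIso Δ ε S Δ ε S (κ.comp θ.toLinearMap) ∧
        ∀ y z, ad Δ S (κ (θ y)) (κ (θ z)) = κ (θ (ad Δ S y z))) ∧
      -- (d)
      (IsAlgQAntiIso (κ.comp S.toLinearMap) ∧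
        ∀ y z, ad Δ S (κ (S y)) (κ (S z)) = κ (S (ad Δ S (S.symm y) z))) := by
  refine ⟨existsUnique_isComul (cartanMatrix_diag b) (cartanMatrix_nonpos b) hd_symm,
    existsUnique_isCounit, existsUnique_isAntipode, existsUnique_isCartanInvolution,
    existsUnique_isQConj, fun Δ ε S θ κ hΔ hε hS hθ hκ => ⟨⟨isHopfQIso_conj hΔ hε hS hκ,
      hε.map_conj hκ, hΔ.map_conj hκ, hS.map_conj hκ⟩, ad'_conj hΔ hS hκ,
      ⟨isHopfQIso_conj_cartan hΔ hε hS hθ hκ, ad_conj_cartan hΔ hS hθ hκ⟩,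
      isAlgQAntiIso_conj_antipode hS hκ, ad_conj_antipode hΔ hS hκ⟩⟩
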